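/- Let $\mathbb{K}\in\{\mathbb{R},\mathbb{C}\}$ and let $K$ be a $\mathbb{K}$-valued kernel that is square integrable on $\{(x,y):0\le y\le x\le 1\}$, i.e. $(x,y)\mapsto K(1-x,y)$ lies in $L^2(T^2)$, where $T^2=\{(x,y):0\le x,\ 0\le y\le 1-x\}$. For $\alpha,\beta\in\mathbb{N}_0$ let $\tilde P^{(\alpha,\beta)}_n(x)=P^{(\alpha,\beta)}_n(2x-1)$ be the Jacobi polynomials shifted to $[0,1]$, normalised to be orthonormal for $(1-x)^\alpha x^\beta\,dx$, and let $p_{n,k}$ ($0\le k\le n$) be the Jacobi polynomials $(1-x)^k\tilde P^{(2k+1,0)}_{n-k}(x)\tilde P^{(0,0)}_k\!\left(\frac{y}{1-x}\right)$ on $T^2$, normalised to be orthonormal in $L^2(T^2)$. All coefficient vectors refer to these bases. Let - $\mathrm{E}_y$ map the coefficients of $u$ in $(\tilde P^{(1,0)}_n)$ to those of $(x,y)\mapsto u(y)$ in $(p_{n,k})$; - $\mathrm{J}_x,\mathrm{J}_y$ be multiplication by $x$, $y$ on coefficient vectors in $(p_{n,k})$, and $K(\mathbb{1}-\mathrm{J}_x,\mathrm{J}_y)=\sum_{n,k}\kappa_{n,k}\,p_{n,k}(\mathrm{J}_x,\mathrm{J}_y)$,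 where $\kappa_{n,k}=\int_{T^2}K(1-x,y)\,p_{n,k}(x,y)\,dx\,dy$ (entrywise this is a finite sum); - $\mathrm{Q}_y$ map $(f_{n,k})$ to $(f_{n,0})_n$, which represents $f\mapsto (1-x)^{-1}\int_0^{1-x}f(x,y)\,dy$ in $(\tilde P^{(1,0)}_n)$; - $\mathrm{L}_{(1,0)}^{(0,0)}$ map the coefficients of $f$ in $(\tilde P^{(1,0)}_n)$ to those of $(1-x)f(x)$ in $(\tilde P^{(0,0)}_n)$; - $\mathrm{R}$ map $(f_n)$ to $((-1)^nf_n)$, which represents $f(x)\mapsto f(1-x)$ in $(\tilde P^{(0,0)}_n)$; - $\mathrm{S}_{(0,0)}^{(1,0)}$ map the coefficients of $f$ in $(\tilde P^{(0,0)}_n)$ to those of $f$ in $(\tilde P^{(1,0)}_n)$. These are infinite matrices whose product $\mathrm{S}_{(0,0)}^{(1,0)}\mathrm{R}\,\mathrm{L}_{(1,0)}^{(0,0)}\mathrm{Q}_yK(\mathbb{1}-\mathrm{J}_x,\mathrm{J}_y)\mathrm{E}_y$ is defined on finitely supported vectors. Then the analysis operator $\mathcal{E}u=\left(\int_0^1 u(x)\,\tilde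 P^{(1,0)}_n(x)\,(1-x)\,dx\right)_{n\ge0}$ is an isometric isomorphism of $L^2((0,1),(1-x)\,dx)$ onto $\ell^2$; the composite $\mathrm{S}_{(0,0)}^{(1,0)}\mathrm{R}\,\mathrm{L}_{(1,0)}^{(0,0)}\mathrm{Q}_yK(\mathbb{1}-\mathrm{J}_x,\mathrm{J}_y)\mathrm{E}_y$ extends to a bounded operator $C$ on $\ell^2$, and $C$ is compact. Consequently, with the compact operator $\mathcal{K}=-C$, for every $u\in L^2((0,1),(1-x)\,dx)$ the integral $\int_0^xK(x,y)u(y)\,dy$ converges absolutely for almost every $x\in(0,1)$, and for every $g\in L^2((0,1),(1-x)\,dx)$ $$u(x)-\int_0^xK(x,y)u(y)\,dy=g(x)\ \text{ for a.e. }x\in(0,1)\quad\Longleftrightarrow\quad(\mathbb{1}+\mathcal{K})\,\mathcal{E}u=\mathcal{E}g .$$ -/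

import Mathlib

open MeasureTheory

noncomputable section

namespace VolterraJacobi

/-! ### Jacobi polynomials on the interval `[0,1]` -/

/-- The Jacobi polynomial `P_n^{(α,β)}` (standard normalisation, `α, β ∈ ℕ`) shifted to `[0,1]`:
`P̃_n^{(α,β)}(x) = P_n^{(α,β)}(2x-1) = ∑ₛ C(n+α, n-s) C(n+β, s) (x-1)^s x^{n-s}`. -/
def shiftedJacobi (α β n : ℕ) : Polynomial ℝ :=
  ∑ s ∈ Finset.range (n + 1),
    Polynomial.C (((n + α).choose (n - s) : ℝ) * ((n + β).choose s : ℝ)) *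
      ((Polynomial.X - 1) ^ s * Polynomial.X ^ (n - s))

/-- The weighted inner product `∫₀¹ p(x) q(x) (1-x)^α x^β dx`, for which the `P̃_n^{(α,β)}` are
orthogonal. -/
def jacobiInner (α β : ℕ) (p q : Polynomial ℝ) : ℝ :=
  ∫ x in (0 : ℝ)..1, p.eval x * q.eval x * ((1 - x) ^ α * x ^ β)

/-- The orthonormal shifted Jacobi polynomials on `[0,1]`. -/
def jacobi (α β n : ℕ) : Polynomial ℝ :=
  Polynomial.C (√(jacobiInner α β (shiftedJacobi α β n) (shiftedJacobi α β n)))⁻¹ *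
    shiftedJacobi α β n

/-- The Jacobi weight `(1-x) dx` on `(0,1)` that belongs to the basis `P̃^{(1,0)}`. -/
def jacobiMeasure : Measure ℝ :=
  (volume.restrict (Set.Ioo 0 1)).withDensity fun x => ENNReal.ofReal (1 - x)

/-! ### Jacobi polynomials on the triangle -/

/-- The canonical triangle `T² = {(x,y) : 0 ≤ x, 0 ≤ y ≤ 1-x}`. -/
def triangle : Set (ℝ × ℝ) := {p | 0 ≤ p.1 ∧ 0 ≤ p.2 ∧ p.2 ≤ 1 - p.1}

/-- Index `⟨n, k⟩`, `0 ≤ k ≤ n`, of a triangle Jacobi polynomial of total degree `n`. -/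
abbrev TriIndex : Type := Σ n : ℕ, Fin (n + 1)

/-- The triangle Jacobi polynomial
`P_{k,n}^{(0,0,0)}(x,y) = (1-x)^k P̃_{n-k}^{(2k+1,0)}(x) P̃_k^{(0,0)}(y/(1-x))`, multiplied out (so that
no division occurs) with the powers of `x` on the left of those of `y`, and evaluated at a pair of
elements of a real algebra.  See `triJacobi_eq`. -/
def triJacobi {A : Type*} [Ring A] [Algebra ℝ A] (a : TriIndex) (x y : A) : A :=
  Polynomial.aeval x (shiftedJacobi (2 * (a.2 : ℕ) + 1) 0 (a.1 - (a.2 : ℕ))) *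
    ∑ j ∈ Finset.range ((a.2 : ℕ) + 1),
      (shiftedJacobi 0 0 (a.2 : ℕ)).coeff j • ((1 - x) ^ ((a.2 : ℕ) - j) * y ^ j)

theorem natDegree_shiftedJacobi_le (α β n : ℕ) : (shiftedJacobi α β n).natDegree ≤ n := by
  unfold shiftedJacobi
  refine Polynomial.natDegree_sum_le_of_forall_le _ _ fun s hs => ?_
  have hs' : s ≤ n := Nat.lt_succ_iff.mp (Finset.mem_range.mp hs)
  refine (Polynomial.natDegree_C_mul_le _ _).trans ?_
  refine Polynomial.natDegree_mul_le.trans ?_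
  have h1 : ((Polynomial.X - 1 : Polynomial ℝ) ^ s).natDegree ≤ s := by
    refine Polynomial.natDegree_pow_le.trans ?_
    have : (Polynomial.X - 1 : Polynomial ℝ).natDegree ≤ 1 := by
      rw [← Polynomial.C_1]
      exact (Polynomial.natDegree_X_sub_C (1 : ℝ)).le
    nlinarith
  have h2 : ((Polynomial.X : Polynomial ℝ) ^ (n - s)).natDegree ≤ n - s :=
    Polynomial.natDegree_X_pow_le _
  omega

theorem triJacobi_eq (a : TriIndex) {x : ℝ} (hx : x ≠ 1) (y : ℝ) :
    triJacobi a x y = (1 - x) ^ (a.2 : ℕ) *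
      (shiftedJacobi (2 * (a.2 : ℕ) + 1) 0 (a.1 - (a.2 : ℕ))).eval x *
        (shiftedJacobi 0 0 (a.2 : ℕ)).eval (y / (1 - x)) := by
  have hx' : (1 - x) ≠ 0 := sub_ne_zero.mpr (Ne.symm hx)
  rw [Polynomial.eval_eq_sum_range'
    (Nat.lt_succ_of_le (natDegree_shiftedJacobi_le 0 0 (a.2 : ℕ))) (y / (1 - x))]
  rw [triJacobi, Polynomial.coe_aeval_eq_eval, mul_comm ((1 - x) ^ (a.2 : ℕ)), mul_assoc,
    Finset.mul_sum (s := Finset.range ((a.2 : ℕ) + 1)) (a := (1 - x) ^ (a.2 : ℕ))]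
  congr 1
  refine Finset.sum_congr rfl fun j hj => ?_
  have hj' : j ≤ (a.2 : ℕ) := Nat.lt_succ_iff.mp (Finset.mem_range.mp hj)
  have : (1 - x) ^ (a.2 : ℕ) = (1 - x) ^ ((a.2 : ℕ) - j) * (1 - x) ^ j := by
    rw [← pow_add, Nat.sub_add_cancel hj']
  rw [this, div_pow, smul_eq_mul]
  field_simp

/-- The triangle Jacobi polynomials, orthonormal in `L²(T²)`. -/
def triBasis {A : Type*} [Ring A] [Algebra ℝ A] (a : TriIndex) (x y : A) : A :=
  (√(∫ p in triangle, triJacobi a p.1 p.2 ^ 2))⁻¹ • triJacobi a x y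

section Operators

variable (𝕜 : Type*) [RCLike 𝕜]

/-- The finite vector of the coefficients, up to total degree `N`, of a function on the triangle in
the orthonormal triangle basis (for a polynomial of degree at most `N`: all its coefficients). -/
def triCoeff (N : ℕ) (f : ℝ × ℝ → ℝ) : TriIndex →₀ 𝕜 :=
  ∑ n ∈ Finset.range (N + 1), ∑ k : Fin (n + 1),
    Finsupp.single (⟨n, k⟩ : TriIndex)
      ((∫ p in triangle, f p * triBasis (⟨n, k⟩ : TriIndex) p.1 p.2 : ℝ) : 𝕜)

/-- `E_y`: from the coefficients of `u(x)` in the basis `P̃^{(1,0)}` to the coefficients of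
`(x,y) ↦ u(y)` in the triangle basis. -/
def extendY : (ℕ →₀ 𝕜) →ₗ[𝕜] (TriIndex →₀ 𝕜) :=
  Finsupp.linearCombination 𝕜 fun n => triCoeff 𝕜 n fun p => (jacobi 1 0 n).eval p.2

/-- `J_x`: multiplication by `x` on coefficients in the triangle basis. -/
def jacobiX : Module.End 𝕜 (TriIndex →₀ 𝕜) :=
  Finsupp.linearCombination 𝕜 fun a => triCoeff 𝕜 (a.1 + 1) fun p => p.1 * triBasis a p.1 p.2

/-- `J_y`: multiplication by `y` on coefficients in the triangle basis. -/
def jacobiY : Module.End 𝕜 (TriIndex →₀ 𝕜) :=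
  Finsupp.linearCombination 𝕜 fun a => triCoeff 𝕜 (a.1 + 1) fun p => p.2 * triBasis a p.1 p.2

variable {𝕜}

/-- `F(J_x, J_y)` for a function `F` on the triangle: `F = ∑_c F_c p_c` is expanded in the triangle
basis and `F(J_x,J_y) = ∑_c F_c p_c(J_x,J_y)`.  By orthogonality only the finitely many `c` of degree
at most `deg a + deg b` contribute to the `b`-th entry of the `a`-th column. -/
def kernelCalculus (F : ℝ × ℝ → 𝕜) : (TriIndex →₀ 𝕜) →ₗ[𝕜] (TriIndex → 𝕜) :=
  Finsupp.linearCombination 𝕜 fun a b =>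
    ∑' c : TriIndex, (∫ p in triangle, F p * ((triBasis c p.1 p.2 : ℝ) : 𝕜)) *
      (triBasis c (jacobiX 𝕜) (jacobiY 𝕜) (Finsupp.single a 1)) b

/-- `Q_y`: from the triangle basis to `P̃^{(1,0)}`; each block is the row `(1, 0, …, 0)`.  It represents
`f ↦ (1-x)⁻¹ ∫₀^{1-x} f(x,y) dy`. -/
def integrateY : (TriIndex → 𝕜) →ₗ[𝕜] (ℕ → 𝕜) where
  toFun f n := f ⟨n, 0⟩
  map_add' _ _ := rfl
  map_smul' _ _ := rfl

/-- The weighted lowering operator `L_{(1,0)}^{(0,0)}`: from the coefficients of `f` in `P̃^{(1,0)}` to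
those of `(1-x) f(x)` in `P̃^{(0,0)}`.  Its matrix is lower bidiagonal. -/
def lowering : (ℕ → 𝕜) →ₗ[𝕜] (ℕ → 𝕜) where
  toFun f m := ∑ n ∈ Finset.range (m + 1),
    ((jacobiInner 0 0 (jacobi 0 0 m) ((1 - Polynomial.X) * jacobi 1 0 n) : ℝ) : 𝕜) * f n
  map_add' f g := by
    ext m
    simp only [Pi.add_apply, mul_add, Finset.sum_add_distrib]
  map_smul' c f := by
    ext m
    simp only [Pi.smul_apply, smul_eq_mul, RingHom.id_apply, Finset.mul_sum, mul_left_comm]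

/-- The reflection `R`: `f ↦ f(1-x)` in the basis `P̃^{(0,0)}`. -/
def reflection : (ℕ → 𝕜) →ₗ[𝕜] (ℕ → 𝕜) where
  toFun f n := (-1) ^ n * f n
  map_add' f g := by
    ext m
    simp only [Pi.add_apply, mul_add]
  map_smul' c f := by
    ext m
    simp only [Pi.smul_apply, smul_eq_mul, RingHom.id_apply, mul_left_comm]

/-- The raising operator `S_{(0,0)}^{(1,0)}`: from the coefficients of `f` in `P̃^{(0,0)}` to those of
the same `f` in `P̃^{(1,0)}`.  Its matrix is upper bidiagonal. -/
def raising : (ℕ → 𝕜) →ₗ[𝕜] (ℕ → 𝕜) where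
  toFun f m := ∑ n ∈ Finset.range (m + 2),
    ((jacobiInner 1 0 (jacobi 1 0 m) (jacobi 0 0 n) : ℝ) : 𝕜) * f n
  map_add' f g := by
    ext m
    simp only [Pi.add_apply, mul_add, Finset.sum_add_distrib]
  map_smul' c f := by
    ext m
    simp only [Pi.smul_apply, smul_eq_mul, RingHom.id_apply, Finset.mul_sum, mul_left_comm]

/-- `S_{(0,0)}^{(1,0)} R L_{(1,0)}^{(0,0)} Q_y K(1-J_x, J_y) E_y`, on finitely supported vectors. -/
def secondKindComposite (K : ℝ → ℝ → 𝕜) : (ℕ →₀ 𝕜) →ₗ[𝕜] (ℕ → 𝕜) :=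
  raising ∘ₗ reflection ∘ₗ lowering ∘ₗ integrateY ∘ₗ
    kernelCalculus (fun p => K (1 - p.1) p.2) ∘ₗ extendY 𝕜

end Operators

end VolterraJacobi

end

open VolterraJacobi

namespace VolterraJacobi

/-! The composite is the matrix, in the basis `jacobi 1 0`, of the Volterra operator `V u (x) =
∫_0^x K(x,y) u(y) dy` on `L²((0,1), (1-x) dx)`. Once this is known, `C` is the conjugate of `V` by
the unitary analysis operator, and everything reduces to `V` being compact.

Compactness: relative to the measure `(1-y) dy` the kernel of `V` is `K(x,y)/(1-y)` on `y ≤ x`, so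
its squared Hilbert–Schmidt norm is `∫∫ |K|² (1-x)/(1-y)`, at most `∫∫ |K|²` because `y ≤ x`
(`memLp_volterraKernel`). Square integrable kernels give Hilbert–Schmidt, hence compact, operators
(`isCompactOperator_integralOperator`).

Identification of the matrix: synthesis from coefficients turns `J_x`, `J_y` into multiplication by
the coordinates. A product `p_a p_b` has a finite expansion in the triangle basis, so the entries of
`K(1-J_x, J_y)` are exactly the integrals `∫ K(1-x,y) p_a p_b` (`kernelCalculus_single`). Since
`p_{n,0}` is `jacobi 1 0 n` in `x`, applying `Q_y` leaves the moments of `G(x,y) = K(1-x,y) u(y)`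
against that basis. The matrices `L`, `R`, `S` then act on moment sequences by changing the test
polynomial: `P_m^{(1,0)}(x) → P_m^{(0,0)}(x) → P_m^{(0,0)}(1-x) → x P_m^{(1,0)}(1-x)`. All these
sums are finite. Fubini and `x ↦ 1-x` convert the last moment into the weighted inner product of `V
u` with `P_m^{(1,0)}` (`secondKindComposite_eq_integral`). -/

open Polynomial in
/-- Integration of polynomials over `[0,1]` as a linear functional. -/
noncomputable def unitIntegral : ℝ[X] →ₗ[ℝ] ℝ where
  toFun p := ∫ x in (0 : ℝ)..1, p.eval x
  map_add' p q := by
    simp only [eval_add]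
    exact intervalIntegral.integral_add (p.continuous.intervalIntegrable _ _)
      (q.continuous.intervalIntegrable _ _)
  map_smul' c p := by
    simp only [eval_smul, smul_eq_mul, RingHom.id_apply, intervalIntegral.integral_const_mul]

/-! ### Orthogonality, expansions and parity of Jacobi polynomials on `[0,1]`. -/

section Interval

open Polynomial

theorem jacobiInner_eq_unitIntegral (α β : ℕ) (p q : ℝ[X]) :
    jacobiInner α β p q = unitIntegral (p * q * ((1 - X) ^ α * X ^ β)) := by
  simp [jacobiInner, unitIntegral]

theorem jacobiInner_comm (α β : ℕ) (p q : ℝ[X]) :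
    jacobiInner α β p q = jacobiInner α β q p := by
  simp only [jacobiInner, mul_comm (eval _ p)]

theorem jacobiInner_C_mul_left (α β : ℕ) (c : ℝ) (p q : ℝ[X]) :
    jacobiInner α β (C c * p) q = c * jacobiInner α β p q := by
  rw [jacobiInner_eq_unitIntegral, mul_assoc, mul_assoc, ← smul_eq_C_mul, map_smul, smul_eq_mul,
    ← mul_assoc, jacobiInner_eq_unitIntegral]

theorem jacobiInner_C_mul_right (α β : ℕ) (c : ℝ) (p q : ℝ[X]) :
    jacobiInner α β p (C c * q) = c * jacobiInner α β p q := by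
  rw [jacobiInner_comm, jacobiInner_C_mul_left, jacobiInner_comm]

theorem jacobiInner_sum_right {ι : Type*} (α β : ℕ) (p : ℝ[X]) (s : Finset ι) (q : ι → ℝ[X]) :
    jacobiInner α β p (∑ i ∈ s, q i) = ∑ i ∈ s, jacobiInner α β p (q i) := by
  simp only [jacobiInner_eq_unitIntegral, Finset.mul_sum, Finset.sum_mul, map_sum]

theorem unitIntegral_derivative_mul (p q : ℝ[X]) (h0 : p.eval 0 = 0) (h1 : p.eval 1 = 0) :
    unitIntegral (derivative p * q) = -unitIntegral (p * derivative q) := by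
  have h : unitIntegral (derivative (p * q)) = 0 := by
    have := intervalIntegral.integral_eq_sub_of_hasDerivAt (a := 0) (b := 1)
      (fun x _ => (p * q).hasDerivAt x)
      ((derivative (p * q)).continuous.intervalIntegrable _ _)
    simpa [unitIntegral, h0, h1] using this
  rw [derivative_mul, map_add] at h
  linarith

theorem unitIntegral_iterate_derivative_mul (p : ℝ[X]) (n : ℕ)
    (h0 : ∀ i < n, (derivative^[i] p).eval 0 = 0) (h1 : ∀ i < n, (derivative^[i] p).eval 1 = 0)
    (q : ℝ[X]) :
    unitIntegral (derivative^[n] p * q) = (-1) ^ n * unitIntegral (p * derivative^[n] q) := by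
  induction n generalizing q with
  | zero => simp
  | succ n ih =>
    rw [Function.iterate_succ_apply', unitIntegral_derivative_mul _ _ (h0 n (by omega))
      (h1 n (by omega)), ih (fun i hi => h0 i (by omega)) (fun i hi => h1 i (by omega)),
      Function.iterate_succ_apply, pow_succ]
    ring

/-- Rodrigues' formula. -/
theorem iterate_derivative_jacobi_weight (α β n : ℕ) :
    derivative^[n] ((X - 1 : ℝ[X]) ^ (n + α) * X ^ (n + β)) =
      C (n.factorial : ℝ) * ((X - 1) ^ α * X ^ β * shiftedJacobi α β n) := by
  rw [iterate_derivative_mul, shiftedJacobi, Finset.mul_sum, Finset.mul_sum]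
  refine Finset.sum_congr rfl fun k hk => ?_
  have hk' : k ≤ n := Nat.lt_succ_iff.mp (Finset.mem_range.mp hk)
  rw [iterate_derivative_X_pow_eq_smul, ← C_1, iterate_derivative_X_sub_pow, C_1]
  have e1 : n + α - (n - k) = α + k := by omega
  have e2 : n + β - k = β + (n - k) := by omega
  -- In the Leibniz sum the falling factorials contribute `(n-k)!` and `k!`, which combine with
  -- `n.choose k` to the common factor `n!`.
  rw [e1, e2, pow_add, pow_add, Nat.descFactorial_eq_factorial_mul_choose,
    Nat.descFactorial_eq_factorial_mul_choose, ← Nat.choose_mul_factorial_mul_factorial hk']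
  simp only [nsmul_eq_mul, smul_eq_C_mul, Nat.cast_mul, map_mul, map_natCast]
  ring

/-- By Rodrigues' formula the weighted polynomial is an `n`-th derivative of a function with zeros
of order at least `n` at both endpoints. Integrating by parts `n` times leaves no boundary terms and
differentiates `q` to zero. -/
theorem jacobiInner_shiftedJacobi_eq_zero (α β n : ℕ) (q : ℝ[X]) (hq : q.natDegree < n) :
    jacobiInner α β (shiftedJacobi α β n) q = 0 := by
  have hz : ∀ a : ℝ, (∃ m, n ≤ m ∧ (X - C a) ^ m ∣ ((X - 1 : ℝ[X]) ^ (n + α) * X ^ (n + β))) →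
      ∀ i < n, (derivative^[i] ((X - 1 : ℝ[X]) ^ (n + α) * X ^ (n + β))).eval a = 0 := by
    rintro a ⟨m, hm, hd⟩ i hi
    have h := pow_sub_dvd_iterate_derivative_of_pow_dvd i hd
    have h' : (X - C a) ∣ derivative^[i] ((X - 1 : ℝ[X]) ^ (n + α) * X ^ (n + β)) :=
      (dvd_pow_self _ (by omega)).trans h
    exact dvd_iff_isRoot.mp h'
  have h := unitIntegral_iterate_derivative_mul ((X - 1 : ℝ[X]) ^ (n + α) * X ^ (n + β)) n
    (hz 0 ⟨n + β, by omega, by simp⟩) (hz 1 ⟨n + α, by omega, by simp⟩) q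
  rw [iterate_derivative_eq_zero hq, mul_zero, map_zero, mul_zero,
    iterate_derivative_jacobi_weight, mul_assoc, ← smul_eq_C_mul, map_smul, smul_eq_mul] at h
  have h' := (mul_eq_zero.mp h).resolve_left (by positivity)
  rw [jacobiInner_eq_unitIntegral]
  -- Rodrigues' formula carries `(X - 1) ^ α` whereas the weight is `(1 - X) ^ α`; only a sign
  -- separates them.
  have e : shiftedJacobi α β n * q * ((1 - X) ^ α * X ^ β) =
      C ((-1 : ℝ) ^ α) * ((X - 1) ^ α * X ^ β * shiftedJacobi α β n * q) := by
    have : (1 - X : ℝ[X]) = C (-1) * (X - 1) := by simp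
    rw [this, mul_pow, C_pow]
    ring
  rw [e, ← smul_eq_C_mul, map_smul, h', smul_zero]

/-- Every summand `(X - 1) ^ s * X ^ (n - s)` is monic of degree `n`, so the leading coefficient is
a sum of positive binomial products. Hence the degree is exactly `n`, which makes triangular
elimination possible. -/
theorem coeff_shiftedJacobi_pos (α β n : ℕ) : 0 < (shiftedJacobi α β n).coeff n := by
  have key : ∀ s ≤ n, (((X : ℝ[X]) - 1) ^ s * X ^ (n - s)).coeff n = 1 := by
    intro s hs
    have hm : (((X : ℝ[X]) - 1) ^ s * X ^ (n - s)).Monic := by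
      rw [← C_1]
      exact ((monic_X_sub_C _).pow s).mul (monic_X_pow _)
    have hd : (((X : ℝ[X]) - 1) ^ s * X ^ (n - s)).natDegree = n := by
      rw [← C_1, ((monic_X_sub_C (1 : ℝ)).pow s).natDegree_mul (monic_X_pow _),
        (monic_X_sub_C (1 : ℝ)).natDegree_pow, natDegree_X_sub_C, natDegree_X_pow]
      omega
    simpa [hd] using hm.coeff_natDegree
  rw [shiftedJacobi, finsetSum_coeff]
  refine Finset.sum_pos (fun s hs => ?_) ⟨0, by simp⟩
  have hs' : s ≤ n := Nat.lt_succ_iff.mp (Finset.mem_range.mp hs)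
  rw [coeff_C_mul, key s hs', mul_one]
  have h1 : 0 < (n + α).choose (n - s) := Nat.choose_pos (by omega)
  have h2 : 0 < (n + β).choose s := Nat.choose_pos (by omega)
  positivity

theorem jacobiInner_self_pos (α β : ℕ) {p : ℝ[X]} (hp : p ≠ 0) : 0 < jacobiInner α β p p := by
  have hcont : Continuous fun x : ℝ => p.eval x * p.eval x * ((1 - x) ^ α * x ^ β) := by fun_prop
  refine intervalIntegral.integral_pos_iff_support_of_nonneg_ae' ?_
    (hcont.intervalIntegrable _ _) |>.mpr ⟨zero_lt_one, ?_⟩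
  · filter_upwards [ae_restrict_mem measurableSet_uIoc] with x hx
    rw [Set.uIoc_of_le zero_le_one] at hx
    have := sub_nonneg.mpr hx.2
    have := hx.1
    have := mul_self_nonneg (p.eval x)
    simp only [Pi.zero_apply]
    positivity
  · have hsub : Set.Ioo (0 : ℝ) 1 \ (p.rootSet ℝ) ⊆
        (Function.support fun x : ℝ => p.eval x * p.eval x * ((1 - x) ^ α * x ^ β)) ∩
          Set.Ioc 0 1 := by
      rintro x ⟨⟨hx0, hx1⟩, hx⟩
      refine ⟨?_, hx0, hx1.le⟩
      have hpx : p.eval x ≠ 0 := fun h => hx (by simpa [mem_rootSet, hp] using h)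
      have := hx0.ne'
      have := (sub_pos.mpr hx1).ne'
      simp only [Function.mem_support]
      positivity
    refine lt_of_lt_of_le ?_ (measure_mono hsub)
    rw [measure_sdiff_null ((p.rootSet_finite ℝ).measure_zero _)]
    simp

theorem shiftedJacobi_ne_zero (α β n : ℕ) : shiftedJacobi α β n ≠ 0 := fun h => by
  simpa [h] using coeff_shiftedJacobi_pos α β n

theorem jacobiInner_jacobi (α β m n : ℕ) :
    jacobiInner α β (jacobi α β m) (jacobi α β n) = if m = n then 1 else 0 := by
  rw [jacobi, jacobi, jacobiInner_C_mul_left, jacobiInner_C_mul_right]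
  rcases lt_trichotomy m n with h | rfl | h
  · rw [jacobiInner_comm α β (shiftedJacobi α β m) (shiftedJacobi α β n),
      jacobiInner_shiftedJacobi_eq_zero _ _ _ _
      ((natDegree_shiftedJacobi_le α β m).trans_lt h), if_neg h.ne, mul_zero, mul_zero]
  · have := jacobiInner_self_pos α β (shiftedJacobi_ne_zero α β m)
    rw [if_pos rfl, ← mul_assoc, ← mul_inv, Real.mul_self_sqrt this.le, inv_mul_cancel₀ this.ne']
  · rw [jacobiInner_shiftedJacobi_eq_zero _ _ _ _
      ((natDegree_shiftedJacobi_le α β n).trans_lt h), if_neg h.ne', mul_zero, mul_zero]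

theorem natDegree_jacobi_le (α β n : ℕ) : (jacobi α β n).natDegree ≤ n :=
  (natDegree_C_mul_le _ _).trans (natDegree_shiftedJacobi_le α β n)

theorem exists_eq_sum_shiftedJacobi (α β N : ℕ) (p : ℝ[X]) (hp : p.natDegree ≤ N) :
    ∃ c : ℕ → ℝ, p = ∑ n ∈ Finset.range (N + 1), C (c n) * shiftedJacobi α β n := by
  induction N generalizing p with
  | zero =>
    have h0 := (coeff_shiftedJacobi_pos α β 0).ne'
    have e1 := eq_C_of_natDegree_le_zero hp
    have e2 := eq_C_of_natDegree_le_zero (natDegree_shiftedJacobi_le α β 0)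
    refine ⟨fun _ => p.coeff 0 / (shiftedJacobi α β 0).coeff 0, ?_⟩
    rw [zero_add, Finset.sum_range_one, e2, ← C_mul, coeff_C_zero, div_mul_cancel₀ _ h0, ← e1]
  | succ N ih =>
    have h0 := (coeff_shiftedJacobi_pos α β (N + 1)).ne'
    set d := p.coeff (N + 1) / (shiftedJacobi α β (N + 1)).coeff (N + 1)
    have hr : (p - C d * shiftedJacobi α β (N + 1)).natDegree ≤ N := by
      refine natDegree_le_iff_coeff_eq_zero.mpr fun m hm => ?_
      rcases (Nat.succ_le_iff.mpr hm).eq_or_lt with rfl | hm'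
      · rw [coeff_sub, coeff_C_mul]
        simp only [Nat.succ_eq_add_one, d]
        rw [div_mul_cancel₀ _ h0, sub_self]
      · rw [coeff_sub, coeff_C_mul, coeff_eq_zero_of_natDegree_lt (hp.trans_lt hm'),
          coeff_eq_zero_of_natDegree_lt
            ((natDegree_shiftedJacobi_le α β (N + 1)).trans_lt hm'), mul_zero, sub_zero]
    obtain ⟨c, hc⟩ := ih _ hr
    refine ⟨fun n => if n = N + 1 then d else c n, ?_⟩
    rw [Finset.sum_range_succ]
    beta_reduce
    rw [if_pos rfl, ← sub_eq_iff_eq_add, hc]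
    refine Finset.sum_congr rfl fun n hn => ?_
    rw [if_neg (by have := Finset.mem_range.mp hn; omega)]

theorem C_sqrt_mul_jacobi (α β n : ℕ) :
    C √(jacobiInner α β (shiftedJacobi α β n) (shiftedJacobi α β n)) * jacobi α β n =
      shiftedJacobi α β n := by
  have := jacobiInner_self_pos α β (shiftedJacobi_ne_zero α β n)
  rw [jacobi, ← mul_assoc, ← C_mul, mul_inv_cancel₀ (Real.sqrt_pos.mpr this).ne', C_1, one_mul]

theorem eq_sum_jacobiInner_mul_jacobi (α β N : ℕ) (p : ℝ[X]) (hp : p.natDegree ≤ N) :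
    p = ∑ n ∈ Finset.range (N + 1), C (jacobiInner α β (jacobi α β n) p) * jacobi α β n := by
  obtain ⟨c, hc⟩ : ∃ c : ℕ → ℝ, p = ∑ n ∈ Finset.range (N + 1), C (c n) * jacobi α β n := by
    obtain ⟨c, hc⟩ := exists_eq_sum_shiftedJacobi α β N p hp
    refine ⟨fun n => c n * √(jacobiInner α β (shiftedJacobi α β n) (shiftedJacobi α β n)),
      hc.trans (Finset.sum_congr rfl fun n _ => ?_)⟩
    rw [C_mul, mul_assoc, C_sqrt_mul_jacobi]
  conv_lhs => rw [hc]
  refine Finset.sum_congr rfl fun n hn => ?_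
  congr 2
  rw [hc, jacobiInner_sum_right]
  simp only [jacobiInner_C_mul_right, jacobiInner_jacobi]
  simp only [mul_ite, mul_one, mul_zero, Finset.sum_ite_eq, if_pos hn]

/-- The reflection exchanges `X - 1` and `X` up to sign, so it pairs the summand `s` with `n - s`;
for `α = β = 0` their binomial coefficients agree. -/
theorem shiftedJacobi_comp_one_sub_X (n : ℕ) :
    (shiftedJacobi 0 0 n).comp (1 - X) = (-1) ^ n * shiftedJacobi 0 0 n := by
  rw [shiftedJacobi]
  conv_lhs => rw [← Finset.sum_range_reflect]
  rw [← coe_compRingHom_apply, map_sum, Finset.mul_sum]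
  refine Finset.sum_congr rfl fun s hs => ?_
  have hs' : s ≤ n := Nat.lt_succ_iff.mp (Finset.mem_range.mp hs)
  have e1 : n + 1 - 1 - s = n - s := by omega
  have e2 : n - (n - s) = s := by omega
  have e3 : (-1 : ℝ[X]) ^ n = (-1) ^ (n - s) * (-1) ^ s := by rw [← pow_add, Nat.sub_add_cancel hs']
  have e4 : (1 - X - 1 : ℝ[X]) = (-1) * X := by ring
  have e5 : (1 - X : ℝ[X]) = (-1) * (X - 1) := by ring
  simp only [coe_compRingHom_apply, e1, e2, add_zero, C_mul, mul_comp, C_comp, pow_comp, sub_comp, X_comp, one_comp, e3]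
  rw [e4, e5, mul_pow, mul_pow]
  ring

theorem eval_one_sub_jacobi (n : ℕ) (x : ℝ) :
    (jacobi 0 0 n).eval (1 - x) = (-1) ^ n * (jacobi 0 0 n).eval x := by
  have h := congrArg (eval x) (shiftedJacobi_comp_one_sub_X n)
  simp only [eval_comp, eval_sub, eval_one, eval_X, eval_mul, eval_pow, eval_neg] at h
  simp only [jacobi, eval_mul, eval_C, h]
  ring

end Interval

/-! ### Orthogonality and completeness by degree of the triangle polynomials. -/

section Triangle

open Polynomial

theorem isCompact_triangle : IsCompact triangle := by
  refine (isCompact_Icc (a := ((0 : ℝ), (0 : ℝ))) (b := (1, 1))).of_isClosed_subset ?_ ?_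
  · exact (isClosed_le continuous_const continuous_fst).inter
      ((isClosed_le continuous_const continuous_snd).inter
        (isClosed_le continuous_snd (continuous_const.sub continuous_fst)))
  · rintro ⟨x, y⟩ ⟨h1, h2, h3⟩
    simp only at h1 h2 h3
    exact ⟨⟨h1, h2⟩, ⟨by simp only; linarith, by simp only; linarith⟩⟩

theorem measurableSet_triangle : MeasurableSet triangle :=
  isCompact_triangle.measurableSet

theorem integrableOn_triangle {f : ℝ × ℝ → ℝ} (hf : Continuous f) : IntegrableOn f triangle :=
  hf.continuousOn.integrableOn_compact isCompact_triangle

/-- Fubini's theorem on the triangle. -/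
theorem setIntegral_triangle {E : Type*} [NormedAddCommGroup E] [NormedSpace ℝ E]
    {f : ℝ × ℝ → E} (hf : IntegrableOn f triangle) :
    ∫ p in triangle, f p = ∫ x in (0 : ℝ)..1, ∫ y in (0 : ℝ)..(1 - x), f (x, y) := by
  rw [← integral_indicator measurableSet_triangle, Measure.volume_eq_prod, integral_prod _
    (by rw [← Measure.volume_eq_prod]; exact hf.integrable_indicator measurableSet_triangle),
    intervalIntegral.integral_of_le zero_le_one, ← integral_Icc_eq_integral_Ioc,
    ← integral_indicator measurableSet_Icc]
  congr 1 with x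
  by_cases hx : x ∈ Set.Icc (0 : ℝ) 1
  · rw [Set.indicator_of_mem hx, intervalIntegral.integral_of_le (by linarith [hx.2]),
      ← integral_Icc_eq_integral_Ioc, ← integral_indicator measurableSet_Icc]
    congr 1 with y
    by_cases hy : y ∈ Set.Icc (0 : ℝ) (1 - x)
    · rw [Set.indicator_of_mem hy, Set.indicator_of_mem (show (x, y) ∈ triangle from
        ⟨hx.1, hy.1, hy.2⟩)]
    · rw [Set.indicator_of_notMem hy, Set.indicator_of_notMem (fun h => hy ⟨h.2.1, h.2.2⟩)]
  · rw [Set.indicator_of_notMem hx, ← integral_zero ℝ E]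
    congr 1 with y
    refine Set.indicator_of_notMem (fun h => hx ⟨h.1, ?_⟩) _
    have := h.2.1.trans h.2.2
    simp only at this
    linarith

theorem continuous_triJacobi (a : TriIndex) : Continuous fun p : ℝ × ℝ => triJacobi a p.1 p.2 := by
  simp only [triJacobi, coe_aeval_eq_eval, smul_eq_mul]
  fun_prop

theorem continuous_triBasis (a : TriIndex) : Continuous fun p : ℝ × ℝ => triBasis a p.1 p.2 :=
  (continuous_triJacobi a).const_mul _

/-- The substitution `t = y / (1 - x)` separates the variables; its Jacobian supplies the extra
power in the exponent `k + l + 1`. -/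
theorem integral_mul_triJacobi (a b : TriIndex) :
    ∫ p in triangle, triJacobi a p.1 p.2 * triJacobi b p.1 p.2 =
      jacobiInner 0 0 (shiftedJacobi 0 0 a.2) (shiftedJacobi 0 0 b.2) *
        ∫ x in (0 : ℝ)..1, (shiftedJacobi (2 * (a.2 : ℕ) + 1) 0 (a.1 - (a.2 : ℕ))).eval x *
          (shiftedJacobi (2 * (b.2 : ℕ) + 1) 0 (b.1 - (b.2 : ℕ))).eval x *
            (1 - x) ^ ((a.2 : ℕ) + b.2 + 1) := by
  rw [setIntegral_triangle (f := fun p => triJacobi a p.1 p.2 * triJacobi b p.1 p.2)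
    (integrableOn_triangle ((continuous_triJacobi a).mul (continuous_triJacobi b))),
    ← intervalIntegral.integral_const_mul]
  refine intervalIntegral.integral_congr_ae ?_
  have h1 : ∀ᵐ x : ℝ, x ≠ 1 := by simp [ae_iff, measure_singleton]
  filter_upwards [h1] with x hx _
  have hx' : 1 - x ≠ 0 := sub_ne_zero.mpr (Ne.symm hx)
  have hy : ∀ y : ℝ, triJacobi a x y * triJacobi b x y =
      ((1 - x) ^ ((a.2 : ℕ) + b.2) *
        (shiftedJacobi (2 * (a.2 : ℕ) + 1) 0 (a.1 - (a.2 : ℕ))).eval x *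
          (shiftedJacobi (2 * (b.2 : ℕ) + 1) 0 (b.1 - (b.2 : ℕ))).eval x) *
      (fun t => (shiftedJacobi 0 0 a.2).eval t * (shiftedJacobi 0 0 b.2).eval t) (y / (1 - x)) := by
    intro y
    rw [triJacobi_eq a hx, triJacobi_eq b hx]
    ring
  simp only [hy]
  rw [intervalIntegral.integral_const_mul, intervalIntegral.integral_comp_div (fun t =>
    (shiftedJacobi 0 0 a.2).eval t * (shiftedJacobi 0 0 b.2).eval t) hx', zero_div, div_self hx',
    jacobiInner]
  simp only [pow_zero, mul_one, smul_eq_mul]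
  ring

/-- If the second indices differ, the Legendre factor vanishes. If both equal `k`, the remaining
weight `(1-x)^(2k+1)` is the one for which the polynomials in `x` are orthogonal. -/
theorem integral_mul_triJacobi_of_ne {a b : TriIndex} (h : a ≠ b) :
    ∫ p in triangle, triJacobi a p.1 p.2 * triJacobi b p.1 p.2 = 0 := by
  rw [integral_mul_triJacobi]
  have key : ∀ (α β : ℕ) {m n : ℕ}, m ≠ n →
      jacobiInner α β (shiftedJacobi α β m) (shiftedJacobi α β n) = 0 := by
    intro α β m n hmn
    have := jacobiInner_jacobi α β m n
    rw [if_neg hmn] at this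
    rw [← C_sqrt_mul_jacobi, ← C_sqrt_mul_jacobi α β n, jacobiInner_C_mul_left,
      jacobiInner_C_mul_right, this, mul_zero, mul_zero]
  obtain ⟨n, k⟩ := a
  obtain ⟨m, l⟩ := b
  by_cases hkl : (k : ℕ) = l
  · have hnm : n - (k : ℕ) ≠ m - (k : ℕ) := by
      intro e
      have e' : n = m := by omega
      subst e'
      exact h (by rw [Fin.ext hkl])
    have := key (2 * (k : ℕ) + 1) 0 hnm
    simp only [← hkl]
    rw [jacobiInner] at this
    simp only [pow_zero, mul_one] at this
    rw [← two_mul, this, mul_zero]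
  · rw [key 0 0 hkl, zero_mul]

theorem integral_sq_triJacobi (a : TriIndex) :
    ∫ p in triangle, triJacobi a p.1 p.2 ^ 2 =
      jacobiInner 0 0 (shiftedJacobi 0 0 a.2) (shiftedJacobi 0 0 a.2) *
        jacobiInner (2 * (a.2 : ℕ) + 1) 0
          (shiftedJacobi (2 * (a.2 : ℕ) + 1) 0 (a.1 - (a.2 : ℕ)))
          (shiftedJacobi (2 * (a.2 : ℕ) + 1) 0 (a.1 - (a.2 : ℕ))) := by
  simp only [sq]
  rw [integral_mul_triJacobi, jacobiInner.eq_1 (2 * (a.2 : ℕ) + 1)]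
  simp only [pow_zero, mul_one, two_mul]

theorem integral_sq_triJacobi_pos (a : TriIndex) :
    0 < ∫ p in triangle, triJacobi a p.1 p.2 ^ 2 := by
  rw [integral_sq_triJacobi]
  exact mul_pos (jacobiInner_self_pos _ _ (shiftedJacobi_ne_zero _ _ _))
    (jacobiInner_self_pos _ _ (shiftedJacobi_ne_zero _ _ _))

theorem integral_mul_triBasis (a b : TriIndex) :
    ∫ p in triangle, triBasis a p.1 p.2 * triBasis b p.1 p.2 = if a = b then 1 else 0 := by
  simp only [triBasis, smul_eq_mul]
  rw [show (fun p : ℝ × ℝ => (√(∫ p in triangle, triJacobi a p.1 p.2 ^ 2))⁻¹ * triJacobi a p.1 p.2 *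
      ((√(∫ p in triangle, triJacobi b p.1 p.2 ^ 2))⁻¹ * triJacobi b p.1 p.2)) = fun p =>
      ((√(∫ p in triangle, triJacobi a p.1 p.2 ^ 2))⁻¹ *
        (√(∫ p in triangle, triJacobi b p.1 p.2 ^ 2))⁻¹) *
          (triJacobi a p.1 p.2 * triJacobi b p.1 p.2) by ext p; ring, integral_const_mul]
  split_ifs with h
  · subst h
    have := integral_sq_triJacobi_pos a
    simp only [← sq (triJacobi a _ _)]
    rw [← mul_inv, Real.mul_self_sqrt this.le, inv_mul_cancel₀ this.ne']
  · rw [integral_mul_triJacobi_of_ne h, mul_zero]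

/-- This is why `integrateY` only has to pick out the entries with `k = 0`. -/
theorem triBasis_zero_right (n : ℕ) (x y : ℝ) :
    triBasis ⟨n, 0⟩ x y = (jacobi 1 0 n).eval x := by
  have h0 : shiftedJacobi 0 0 0 = 1 := by simp [shiftedJacobi]
  have h1 : jacobiInner 0 0 1 1 = 1 := by simp [jacobiInner]
  rw [triBasis, integral_sq_triJacobi, jacobi]
  simp [triJacobi, h0, h1, coe_aeval_eq_eval]

/-- The functions `x ^ i * y ^ j`, `i + j ≤ N`, span the polynomial functions of degree at most `N`
on the plane. -/
def planePolynomials (N : ℕ) : Submodule ℝ (ℝ × ℝ → ℝ) :=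
  Submodule.span ℝ {f | ∃ i j, i + j ≤ N ∧ f = fun p => p.1 ^ i * p.2 ^ j}

theorem mul_mem_planePolynomials {M N : ℕ} {f g : ℝ × ℝ → ℝ} (hf : f ∈ planePolynomials M)
    (hg : g ∈ planePolynomials N) : f * g ∈ planePolynomials (M + N) := by
  have h := Submodule.mul_mem_mul hf hg
  rw [planePolynomials, planePolynomials, Submodule.span_mul_span] at h
  refine Submodule.span_mono ?_ h
  rintro _ ⟨_, ⟨i, j, hij, rfl⟩, _, ⟨k, l, hkl, rfl⟩, rfl⟩
  refine ⟨i + k, j + l, by omega, ?_⟩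
  ext p
  simp only [Pi.mul_apply]
  ring

theorem eval_mul_pow_mem_planePolynomials {N j : ℕ} {r : ℝ[X]} (h : r.natDegree + j ≤ N) :
    (fun p : ℝ × ℝ => r.eval p.1 * p.2 ^ j) ∈ planePolynomials N := by
  have : (fun p : ℝ × ℝ => r.eval p.1 * p.2 ^ j) =
      ∑ i ∈ Finset.range (r.natDegree + 1), r.coeff i • fun p : ℝ × ℝ => p.1 ^ i * p.2 ^ j := by
    ext p
    simp only [eval_eq_sum_range, Finset.sum_mul, Finset.sum_apply, Pi.smul_apply, smul_eq_mul,
      mul_assoc]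
  rw [this]
  refine Submodule.sum_mem _ fun i hi => Submodule.smul_mem _ _ (Submodule.subset_span
    ⟨i, j, ?_, rfl⟩)
  have := Finset.mem_range.mp hi
  omega

theorem fst_mem_planePolynomials : (fun p : ℝ × ℝ => p.1) ∈ planePolynomials 1 :=
  Submodule.subset_span ⟨1, 0, le_rfl, by simp⟩

theorem snd_mem_planePolynomials : (fun p : ℝ × ℝ => p.2) ∈ planePolynomials 1 :=
  Submodule.subset_span ⟨0, 1, le_rfl, by simp⟩

theorem eval_snd_mem_planePolynomials {N : ℕ} {r : ℝ[X]} (h : r.natDegree ≤ N) :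
    (fun p : ℝ × ℝ => r.eval p.2) ∈ planePolynomials N := by
  have : (fun p : ℝ × ℝ => r.eval p.2) =
      ∑ i ∈ Finset.range (r.natDegree + 1), r.coeff i • fun p : ℝ × ℝ => p.1 ^ 0 * p.2 ^ i := by
    ext p
    simp [eval_eq_sum_range]
  rw [this]
  refine Submodule.sum_mem _ fun i hi => Submodule.smul_mem _ _ (Submodule.subset_span
    ⟨0, i, ?_, rfl⟩)
  have := Finset.mem_range.mp hi
  omega

theorem triJacobi_mem_planePolynomials (a : TriIndex) :
    (fun p : ℝ × ℝ => triJacobi a p.1 p.2) ∈ planePolynomials a.1 := by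
  obtain ⟨n, k⟩ := a
  have hk : (k : ℕ) ≤ n := Nat.lt_succ_iff.mp k.2
  have : (fun p : ℝ × ℝ => triJacobi ⟨n, k⟩ p.1 p.2) = ∑ j ∈ Finset.range ((k : ℕ) + 1),
      (shiftedJacobi 0 0 (k : ℕ)).coeff j • fun p : ℝ × ℝ =>
        (shiftedJacobi (2 * (k : ℕ) + 1) 0 (n - k) * (1 - X) ^ ((k : ℕ) - j)).eval p.1 *
          p.2 ^ j := by
    ext p
    simp only [triJacobi, coe_aeval_eq_eval, Finset.mul_sum, Finset.sum_apply, Pi.smul_apply,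
      smul_eq_mul, eval_mul, eval_pow, eval_sub, eval_one, eval_X]
    exact Finset.sum_congr rfl fun j _ => by ring
  rw [this]
  refine Submodule.sum_mem _ fun j hj => Submodule.smul_mem _ _
    (eval_mul_pow_mem_planePolynomials ?_)
  have hj' := Finset.mem_range.mp hj
  have h1 := natDegree_shiftedJacobi_le (2 * (k : ℕ) + 1) 0 (n - k)
  have h2 : ((1 - X : ℝ[X]) ^ ((k : ℕ) - j)).natDegree ≤ (k : ℕ) - j := by
    refine natDegree_pow_le.trans ?_
    have : (1 - X : ℝ[X]).natDegree ≤ 1 := by compute_degree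
    nlinarith
  have h3 := natDegree_mul_le (p := shiftedJacobi (2 * (k : ℕ) + 1) 0 (n - k))
    (q := (1 - X) ^ ((k : ℕ) - j))
  show _ ≤ n
  omega

theorem triBasis_mem_planePolynomials (a : TriIndex) :
    (fun p : ℝ × ℝ => triBasis a p.1 p.2) ∈ planePolynomials a.1 :=
  Submodule.smul_mem _ _ (triJacobi_mem_planePolynomials a)

/-- The indices of total degree at most `N`. -/
def triIndices (N : ℕ) : Finset TriIndex :=
  (Finset.range (N + 1)).sigma fun _ => Finset.univ

theorem mem_triIndices {N : ℕ} {a : TriIndex} : a ∈ triIndices N ↔ a.1 ≤ N := by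
  simp [triIndices]

theorem triJacobi_mem_span {N : ℕ} {a : TriIndex} (ha : a.1 ≤ N) :
    (fun p : ℝ × ℝ => triJacobi a p.1 p.2) ∈
      Submodule.span ℝ ((fun (b : TriIndex) (p : ℝ × ℝ) => triBasis b p.1 p.2) '' triIndices N) := by
  have hpos := Real.sqrt_pos.mpr (integral_sq_triJacobi_pos a)
  have : (fun p : ℝ × ℝ => triJacobi a p.1 p.2) =
      √(∫ p in triangle, triJacobi a p.1 p.2 ^ 2) • fun p : ℝ × ℝ => triBasis a p.1 p.2 := by
    ext p
    simp only [Pi.smul_apply, triBasis, smul_smul, mul_inv_cancel₀ hpos.ne', one_smul]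
  rw [this]
  exact Submodule.smul_mem _ _ (Submodule.subset_span ⟨a, mem_triIndices.mpr ha, rfl⟩)

/-- Induction on the power of `y`. Expanding `r` in the polynomials with parameter `2j + 1` shows
that `r(x)` times the homogenised Legendre polynomial of degree `j` lies in the span (`htop`). Its
top term in `y` is a nonzero multiple of `r(x) y^j`, and its other terms have lower powers of `y`
without exceeding total degree `N` (`hlow`). -/
theorem eval_mul_pow_mem_span (N j : ℕ) (hj : j ≤ N) (r : ℝ[X]) (hr : r.natDegree ≤ N - j) :
    (fun p : ℝ × ℝ => r.eval p.1 * p.2 ^ j) ∈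
      Submodule.span ℝ ((fun (b : TriIndex) (p : ℝ × ℝ) => triBasis b p.1 p.2) '' triIndices N) := by
  induction j using Nat.strong_induction_on generalizing r with
  | _ j ih =>
    have hl := (coeff_shiftedJacobi_pos 0 0 j).ne'
    obtain ⟨c, hc⟩ := exists_eq_sum_shiftedJacobi (2 * j + 1) 0 (N - j) r hr
    have htop : (fun p : ℝ × ℝ => r.eval p.1 * ∑ i ∈ Finset.range (j + 1),
        (shiftedJacobi 0 0 j).coeff i • ((1 - p.1) ^ (j - i) * p.2 ^ i)) ∈
        Submodule.span ℝ
          ((fun (b : TriIndex) (p : ℝ × ℝ) => triBasis b p.1 p.2) '' triIndices N) := by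
      have : (fun p : ℝ × ℝ => r.eval p.1 * ∑ i ∈ Finset.range (j + 1),
          (shiftedJacobi 0 0 j).coeff i • ((1 - p.1) ^ (j - i) * p.2 ^ i)) =
          ∑ m ∈ Finset.range (N - j + 1), c m • fun p : ℝ × ℝ =>
            triJacobi (⟨m + j, ⟨j, by omega⟩⟩ : TriIndex) p.1 p.2 := by
        ext p
        conv_lhs => rw [hc]
        simp only [triJacobi, coe_aeval_eq_eval, Finset.sum_apply, Pi.smul_apply,
          Nat.add_sub_cancel, eval_finsetSum, eval_mul, eval_C, Finset.sum_mul (s :=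
          Finset.range (N - j + 1)), mul_assoc, smul_eq_mul (a := c _)]
      rw [this]
      refine Submodule.sum_mem _ fun m hm => Submodule.smul_mem _ _ (triJacobi_mem_span ?_)
      have := Finset.mem_range.mp hm
      show m + j ≤ N
      omega
    have hlow : (∑ i ∈ Finset.range j, (shiftedJacobi 0 0 j).coeff i • fun p : ℝ × ℝ =>
        (r * (1 - X) ^ (j - i)).eval p.1 * p.2 ^ i) ∈
        Submodule.span ℝ
          ((fun (b : TriIndex) (p : ℝ × ℝ) => triBasis b p.1 p.2) '' triIndices N) := by
      refine Submodule.sum_mem _ fun i hi => Submodule.smul_mem _ _ ?_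
      have hi' := Finset.mem_range.mp hi
      refine ih i hi' (by omega) _ ?_
      have h2 : ((1 - X : ℝ[X]) ^ (j - i)).natDegree ≤ j - i := by
        refine natDegree_pow_le.trans ?_
        have : (1 - X : ℝ[X]).natDegree ≤ 1 := by compute_degree
        nlinarith
      have h3 := natDegree_mul_le (p := r) (q := (1 - X) ^ (j - i))
      omega
    have h := Submodule.smul_mem _ ((shiftedJacobi 0 0 j).coeff j)⁻¹
      (Submodule.sub_mem _ htop hlow)
    convert h using 1
    ext p
    simp only [Pi.smul_apply, Pi.sub_apply, Finset.sum_apply, smul_eq_mul, eval_mul, eval_pow,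
      eval_sub, eval_one, eval_X, Finset.sum_range_succ, mul_add, Finset.mul_sum, Nat.sub_self,
      pow_zero, one_mul]
    rw [Finset.sum_congr rfl (fun i _ => by ring :
      ∀ i ∈ Finset.range j, eval p.1 r *
        ((shiftedJacobi 0 0 j).coeff i * ((1 - p.1) ^ (j - i) * p.2 ^ i)) =
        (shiftedJacobi 0 0 j).coeff i * (eval p.1 r * (1 - p.1) ^ (j - i) * p.2 ^ i)),
      add_sub_cancel_left]
    field_simp

theorem planePolynomials_le_span (N : ℕ) : planePolynomials N ≤
    Submodule.span ℝ ((fun (b : TriIndex) (p : ℝ × ℝ) => triBasis b p.1 p.2) '' triIndices N) := by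
  refine Submodule.span_le.mpr ?_
  rintro _ ⟨i, j, hij, rfl⟩
  have := eval_mul_pow_mem_span N j (by omega) (X ^ i) (by rw [natDegree_X_pow]; omega)
  simpa using this

theorem integral_sum_mul_triBasis (N : ℕ) (d : TriIndex → ℝ) (b : TriIndex) :
    ∫ q in triangle, (∑ a ∈ triIndices N, d a * triBasis a q.1 q.2) * triBasis b q.1 q.2 =
      if b ∈ triIndices N then d b else 0 := by
  have hint : ∀ a ∈ triIndices N, IntegrableOn
      (fun q : ℝ × ℝ => d a * (triBasis a q.1 q.2 * triBasis b q.1 q.2)) triangle := fun a _ =>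
    integrableOn_triangle (((continuous_triBasis a).mul (continuous_triBasis b)).const_mul (d a))
  simp only [Finset.sum_mul, mul_assoc]
  rw [integral_finsetSum _ hint]
  simp only [integral_const_mul, integral_mul_triBasis]
  simp

theorem exists_eq_sum_mul_triBasis {N : ℕ} {f : ℝ × ℝ → ℝ} (hf : f ∈ planePolynomials N) :
    ∃ d : TriIndex → ℝ, ∀ p, f p = ∑ a ∈ triIndices N, d a * triBasis a p.1 p.2 := by
  obtain ⟨c, hc⟩ := (Submodule.mem_span_image_finset_iff_exists_fun' ℝ).mp
    (planePolynomials_le_span N hf)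
  exact ⟨c, fun p => by rw [← hc, Finset.sum_apply]; rfl⟩

theorem eq_sum_integral_mul_triBasis {N : ℕ} {f : ℝ × ℝ → ℝ} (hf : f ∈ planePolynomials N)
    (p : ℝ × ℝ) :
    f p = ∑ a ∈ triIndices N, (∫ q in triangle, f q * triBasis a q.1 q.2) * triBasis a p.1 p.2 := by
  obtain ⟨d, hd⟩ := exists_eq_sum_mul_triBasis hf
  simp only [hd, integral_sum_mul_triBasis]
  exact Finset.sum_congr rfl fun b hb => by rw [if_pos hb]

theorem integral_mul_triBasis_eq_zero {N : ℕ} {f : ℝ × ℝ → ℝ} (hf : f ∈ planePolynomials N)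
    {c : TriIndex} (hc : N < c.1) : ∫ q in triangle, f q * triBasis c q.1 q.2 = 0 := by
  obtain ⟨d, hd⟩ := exists_eq_sum_mul_triBasis hf
  simp only [hd, integral_sum_mul_triBasis, mem_triIndices, hc.not_ge, if_false]

end Triangle

/-! ### The matrix product as a moment of the kernel over the triangle. -/

section Coefficients

variable {𝕜 : Type*} [RCLike 𝕜]

variable (𝕜) in
/-- The function on the plane with given coefficients in the triangle basis. -/
noncomputable def triSynthesis : (TriIndex →₀ 𝕜) →ₗ[𝕜] (ℝ × ℝ → 𝕜) :=
  Finsupp.linearCombination 𝕜 fun a p => ((triBasis a p.1 p.2 : ℝ) : 𝕜)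

theorem triSynthesis_single (a : TriIndex) (c : 𝕜) (p : ℝ × ℝ) :
    triSynthesis 𝕜 (Finsupp.single a c) p = c * ((triBasis a p.1 p.2 : ℝ) : 𝕜) := by
  simp [triSynthesis]

theorem triCoeff_eq (N : ℕ) (f : ℝ × ℝ → ℝ) :
    triCoeff 𝕜 N f = ∑ a ∈ triIndices N,
      Finsupp.single a ((∫ p in triangle, f p * triBasis a p.1 p.2 : ℝ) : 𝕜) := by
  rw [triCoeff, triIndices, Finset.sum_sigma]

theorem triSynthesis_triCoeff {N : ℕ} {f : ℝ × ℝ → ℝ} (hf : f ∈ planePolynomials N)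
    (p : ℝ × ℝ) : triSynthesis 𝕜 (triCoeff 𝕜 N f) p = (f p : 𝕜) := by
  rw [triCoeff_eq, map_sum, Finset.sum_apply, eq_sum_integral_mul_triBasis hf p]
  simp only [triSynthesis_single]
  push_cast
  rfl

theorem triSynthesis_linearCombination {ι : Type*} (w : ι → TriIndex →₀ 𝕜) (f : ι → ℝ × ℝ → 𝕜)
    (p : ℝ × ℝ) (d : 𝕜) (h : ∀ i, triSynthesis 𝕜 (w i) p = d * f i p) (v : ι →₀ 𝕜) :
    triSynthesis 𝕜 (Finsupp.linearCombination 𝕜 w v) p =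
      d * Finsupp.linearCombination 𝕜 f v p := by
  induction v using Finsupp.induction_linear with
  | zero => simp
  | add v w hv hw => simp only [map_add, Pi.add_apply, hv, hw, mul_add]
  | single i c => simp [h, mul_left_comm]

theorem triSynthesis_jacobiX (v : TriIndex →₀ 𝕜) (p : ℝ × ℝ) :
    triSynthesis 𝕜 (jacobiX 𝕜 v) p = ((p.1 : ℝ) : 𝕜) * triSynthesis 𝕜 v p := by
  refine triSynthesis_linearCombination _ _ p _ (fun a => ?_) v
  have h := mul_mem_planePolynomials fst_mem_planePolynomials (triBasis_mem_planePolynomials a)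
  rw [add_comm] at h
  rw [← RCLike.ofReal_mul]
  exact triSynthesis_triCoeff h p

theorem triSynthesis_jacobiY (v : TriIndex →₀ 𝕜) (p : ℝ × ℝ) :
    triSynthesis 𝕜 (jacobiY 𝕜 v) p = ((p.2 : ℝ) : 𝕜) * triSynthesis 𝕜 v p := by
  refine triSynthesis_linearCombination _ _ p _ (fun a => ?_) v
  have h := mul_mem_planePolynomials snd_mem_planePolynomials (triBasis_mem_planePolynomials a)
  rw [add_comm] at h
  rw [← RCLike.ofReal_mul]
  exact triSynthesis_triCoeff h p

/-- The function on the line with given coefficients in the basis `P̃^{(1,0)}`. -/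
noncomputable def jacobiSynthesis (v : ℕ →₀ 𝕜) (y : ℝ) : 𝕜 :=
  v.sum fun n c => c * (((jacobi 1 0 n).eval y : ℝ) : 𝕜)

theorem continuous_jacobiSynthesis (v : ℕ →₀ 𝕜) : Continuous (jacobiSynthesis v) :=
  continuous_finsetSum _ fun n _ => continuous_const.mul
    (RCLike.continuous_ofReal.comp (jacobi 1 0 n).continuous)

theorem triSynthesis_extendY (v : ℕ →₀ 𝕜) (p : ℝ × ℝ) :
    triSynthesis 𝕜 (extendY 𝕜 v) p = jacobiSynthesis v p.2 := by
  rw [extendY, Finsupp.linearCombination_apply, Finsupp.sum, map_sum, Finset.sum_apply,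
    jacobiSynthesis, Finsupp.sum]
  refine Finset.sum_congr rfl fun n _ => ?_
  rw [map_smul, Pi.smul_apply, smul_eq_mul, triSynthesis_triCoeff
    (eval_snd_mem_planePolynomials (natDegree_jacobi_le 1 0 n))]

theorem triSynthesis_smul_end (c : ℝ) (T : Module.End 𝕜 (TriIndex →₀ 𝕜)) (v : TriIndex →₀ 𝕜)
    (p : ℝ × ℝ) :
    triSynthesis 𝕜 ((c • T) v) p = (c : 𝕜) * triSynthesis 𝕜 (T v) p := by
  have : (c • T) v = (c : 𝕜) • T v := by
    ext a
    simp [RCLike.real_smul_eq_coe_mul]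
  rw [this, map_smul, Pi.smul_apply, smul_eq_mul]

theorem triSynthesis_pow {T : Module.End 𝕜 (TriIndex →₀ 𝕜)} {t : 𝕜} {p : ℝ × ℝ}
    (hT : ∀ v, triSynthesis 𝕜 (T v) p = t * triSynthesis 𝕜 v p) (n : ℕ) (v : TriIndex →₀ 𝕜) :
    triSynthesis 𝕜 ((T ^ n) v) p = t ^ n * triSynthesis 𝕜 v p := by
  induction n generalizing v with
  | zero => simp
  | succ n ih => rw [pow_succ, Module.End.mul_apply, ih, hT, pow_succ, mul_assoc]

theorem triSynthesis_aeval {T : Module.End 𝕜 (TriIndex →₀ 𝕜)} {t : ℝ} {p : ℝ × ℝ}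
    (hT : ∀ v, triSynthesis 𝕜 (T v) p = t * triSynthesis 𝕜 v p) (q : Polynomial ℝ)
    (v : TriIndex →₀ 𝕜) :
    triSynthesis 𝕜 (Polynomial.aeval T q v) p = ((q.eval t : ℝ) : 𝕜) * triSynthesis 𝕜 v p := by
  rw [Polynomial.aeval_eq_sum_range, Polynomial.eval_eq_sum_range, LinearMap.sum_apply, map_sum,
    Finset.sum_apply]
  simp only [triSynthesis_smul_end, triSynthesis_pow hT]
  push_cast
  simp only [Finset.sum_mul, mul_assoc]

/-- Synthesis intertwines `J_x` and `J_y` with multiplication by the coordinates, hence any fixed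
ordered polynomial in them with multiplication by that polynomial. -/
theorem triSynthesis_triBasis (c : TriIndex) (v : TriIndex →₀ 𝕜) (p : ℝ × ℝ) :
    triSynthesis 𝕜 (triBasis c (jacobiX 𝕜) (jacobiY 𝕜) v) p =
      ((triBasis c p.1 p.2 : ℝ) : 𝕜) * triSynthesis 𝕜 v p := by
  have hX : ∀ w, triSynthesis 𝕜 ((1 - jacobiX 𝕜) w) p =
      ((1 - p.1 : ℝ) : 𝕜) * triSynthesis 𝕜 w p := fun w => by
    rw [LinearMap.sub_apply, map_sub, Pi.sub_apply, triSynthesis_jacobiX, Module.End.one_apply]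
    push_cast
    ring
  rw [triBasis, triSynthesis_smul_end, triJacobi, Module.End.mul_apply,
    triSynthesis_aeval (fun w => triSynthesis_jacobiX w p), LinearMap.sum_apply, map_sum,
    Finset.sum_apply]
  simp only [triSynthesis_smul_end, Module.End.mul_apply, triSynthesis_pow hX,
    triSynthesis_pow (fun w => triSynthesis_jacobiY w p), triBasis, triJacobi,
    Polynomial.coe_aeval_eq_eval, smul_eq_mul]
  push_cast
  simp only [Finset.sum_mul, Finset.mul_sum, mul_assoc]

theorem continuous_triSynthesis (v : TriIndex →₀ 𝕜) : Continuous (triSynthesis 𝕜 v) := by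
  induction v using Finsupp.induction_linear with
  | zero => rw [map_zero]; exact continuous_const
  | add v w hv hw => rw [map_add]; exact hv.add hw
  | single a c =>
    rw [funext (triSynthesis_single a c)]
    exact continuous_const.mul (RCLike.continuous_ofReal.comp (continuous_triBasis a))

theorem continuous_ofReal_triBasis (a : TriIndex) :
    Continuous fun p : ℝ × ℝ => ((triBasis a p.1 p.2 : ℝ) : 𝕜) :=
  RCLike.continuous_ofReal.comp (continuous_triBasis a)

theorem integrableOn_triangle_mul {f g : ℝ × ℝ → 𝕜} (hf : IntegrableOn f triangle)
    (hg : Continuous g) : IntegrableOn (fun p => f p * g p) triangle :=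
  hf.mul_continuousOn hg.continuousOn isCompact_triangle

/-- Coefficients are recovered from the synthesised function, so matrix entries can be computed on
the function side. -/
theorem integral_triSynthesis_mul_triBasis (v : TriIndex →₀ 𝕜) (b : TriIndex) :
    ∫ p in triangle, triSynthesis 𝕜 v p * ((triBasis b p.1 p.2 : ℝ) : 𝕜) = v b := by
  have hint : ∀ w, IntegrableOn
      (fun p => triSynthesis 𝕜 w p * ((triBasis b p.1 p.2 : ℝ) : 𝕜)) triangle := fun w =>
    integrableOn_triangle_mul
      ((continuous_triSynthesis w).continuousOn.integrableOn_compact isCompact_triangle)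
      (continuous_ofReal_triBasis b)
  induction v using Finsupp.induction_linear with
  | zero => simp
  | add v w hv hw =>
    simp only [map_add, Pi.add_apply, add_mul, Finsupp.add_apply]
    rw [integral_add (hint v) (hint w), hv, hw]
  | single a c =>
    simp only [triSynthesis_single, mul_assoc, ← RCLike.ofReal_mul]
    rw [integral_const_mul, integral_ofReal, integral_mul_triBasis, Finsupp.single_apply]
    split_ifs <;> simp

theorem triBasis_jacobiX_jacobiY_single (a b c : TriIndex) :
    triBasis c (jacobiX 𝕜) (jacobiY 𝕜) (Finsupp.single a 1) b =
      ((∫ p in triangle, triBasis a p.1 p.2 * triBasis b p.1 p.2 * triBasis c p.1 p.2 : ℝ) : 𝕜) := by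
  rw [← integral_triSynthesis_mul_triBasis, ← integral_ofReal]
  congr 1 with p
  rw [triSynthesis_triBasis, triSynthesis_single]
  push_cast
  ring

/-- The factor multiplying the coefficient `F_c` is `∫ p_a p_b p_c`, the `c`-th coefficient of `p_a
p_b`. It vanishes beyond degree `a.1 + b.1`, so the series is a finite sum that resums to `p_a p_b`
under the integral; integrability of `F` suffices. -/
theorem kernelCalculus_single {F : ℝ × ℝ → 𝕜} (hF : IntegrableOn F triangle) (a b : TriIndex) :
    kernelCalculus F (Finsupp.single a 1) b =
      ∫ p in triangle, F p * ((triBasis a p.1 p.2 : ℝ) : 𝕜) * ((triBasis b p.1 p.2 : ℝ) : 𝕜) := by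
  have hf := mul_mem_planePolynomials (triBasis_mem_planePolynomials a)
    (triBasis_mem_planePolynomials b)
  rw [kernelCalculus, Finsupp.linearCombination_single, one_smul]
  rw [tsum_eq_sum (s := triIndices (a.1 + b.1)) fun c hc => ?_]
  · simp only [mul_assoc, ← RCLike.ofReal_mul]
    have h : ∀ p : ℝ × ℝ, F p * ((triBasis a p.1 p.2 * triBasis b p.1 p.2 : ℝ) : 𝕜) =
        ∑ c ∈ triIndices (a.1 + b.1), F p * ((triBasis c p.1 p.2 : ℝ) : 𝕜) *
          ((∫ q in triangle, triBasis a q.1 q.2 * triBasis b q.1 q.2 *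
            triBasis c q.1 q.2 : ℝ) : 𝕜) := fun p => by
      have := eq_sum_integral_mul_triBasis hf p
      simp only [Pi.mul_apply] at this
      rw [this]
      push_cast
      rw [Finset.mul_sum]
      exact Finset.sum_congr rfl fun c _ => by ring
    simp only [h]
    rw [integral_finsetSum _ fun c _ =>
      (integrableOn_triangle_mul hF (continuous_ofReal_triBasis c)).mul_const _]
    simp only [integral_mul_const, triBasis_jacobiX_jacobiY_single]
  · rw [triBasis_jacobiX_jacobiY_single]
    have := integral_mul_triBasis_eq_zero hf (c := c) (by
      by_contra h
      exact hc (mem_triIndices.mpr (by omega)))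
    simp only [Pi.mul_apply] at this
    rw [this, RCLike.ofReal_zero, mul_zero]

theorem kernelCalculus_apply {F : ℝ × ℝ → 𝕜} (hF : IntegrableOn F triangle) (v : TriIndex →₀ 𝕜)
    (b : TriIndex) :
    kernelCalculus F v b =
      ∫ p in triangle, F p * triSynthesis 𝕜 v p * ((triBasis b p.1 p.2 : ℝ) : 𝕜) := by
  have hint : ∀ w, IntegrableOn (fun p => F p * triSynthesis 𝕜 w p *
      ((triBasis b p.1 p.2 : ℝ) : 𝕜)) triangle := fun w =>
    integrableOn_triangle_mul (integrableOn_triangle_mul hF (continuous_triSynthesis w))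
      (continuous_ofReal_triBasis b)
  induction v using Finsupp.induction_linear with
  | zero => simp
  | add v w hv hw =>
    simp only [map_add, Pi.add_apply, add_mul, mul_add]
    rw [integral_add (hint v) (hint w), hv, hw]
  | single a c =>
    rw [← mul_one c, ← smul_eq_mul c, ← Finsupp.smul_single, map_smul, Pi.smul_apply,
      kernelCalculus_single hF, smul_eq_mul, ← integral_const_mul]
    congr 1 with p
    rw [map_smul, Pi.smul_apply, triSynthesis_single, smul_eq_mul, one_mul]
    ring

/-- The moments in `x` of a function on the triangle. -/
noncomputable def triMoment (G : ℝ × ℝ → 𝕜) (r : Polynomial ℝ) : 𝕜 :=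
  ∫ p in triangle, G p * ((r.eval p.1 : ℝ) : 𝕜)

/-- A row-finite real matrix acts on moment sequences by recombining the test polynomials. -/
theorem sum_mul_triMoment {G : ℝ × ℝ → 𝕜} (hG : IntegrableOn G triangle) (s : Finset ℕ)
    (c : ℕ → ℝ) (r : ℕ → Polynomial ℝ) :
    ∑ n ∈ s, (c n : 𝕜) * triMoment G (r n) =
      triMoment G (∑ n ∈ s, Polynomial.C (c n) * r n) := by
  simp only [triMoment, ← integral_const_mul]
  rw [← integral_finsetSum]
  · congr 1 with p
    rw [Polynomial.eval_finsetSum]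
    push_cast
    rw [Finset.mul_sum]
    refine Finset.sum_congr rfl fun n _ => ?_
    rw [Polynomial.eval_mul, Polynomial.eval_C]
    push_cast
    ring
  · refine fun n _ => (integrableOn_triangle_mul hG ?_).const_mul _
    exact RCLike.continuous_ofReal.comp ((r n).continuous.comp continuous_fst)

theorem jacobiInner_one_sub_X_mul (p q : Polynomial ℝ) :
    jacobiInner 0 0 p ((1 - Polynomial.X) * q) = jacobiInner 1 0 q p := by
  rw [jacobiInner_eq_unitIntegral, jacobiInner_eq_unitIntegral]
  congr 1
  ring

theorem lowering_apply (f : ℕ → 𝕜) (m : ℕ) :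
    lowering f m = ∑ n ∈ Finset.range (m + 1),
      ((jacobiInner 0 0 (jacobi 0 0 m) ((1 - Polynomial.X) * jacobi 1 0 n) : ℝ) : 𝕜) * f n :=
  rfl

theorem raising_apply (f : ℕ → 𝕜) (m : ℕ) :
    raising f m = ∑ n ∈ Finset.range (m + 2),
      ((jacobiInner 1 0 (jacobi 1 0 m) (jacobi 0 0 n) : ℝ) : 𝕜) * f n :=
  rfl

/-- By `jacobiInner_one_sub_X_mul`, row `k` of the lowering matrix holds the coefficients of `jacobi
0 0 k` in the basis `jacobi 1 0`; its degree `k` accounts for the summation range. -/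
theorem lowering_triMoment {G : ℝ × ℝ → 𝕜} (hG : IntegrableOn G triangle) :
    lowering (fun k => triMoment G (jacobi 1 0 k)) = fun k => triMoment G (jacobi 0 0 k) := by
  ext k
  rw [lowering_apply, sum_mul_triMoment hG]
  congr 1
  conv_rhs => rw [eq_sum_jacobiInner_mul_jacobi 1 0 k _ (natDegree_jacobi_le 0 0 k)]
  simp only [jacobiInner_one_sub_X_mul]

theorem reflection_triMoment (G : ℝ × ℝ → 𝕜) :
    reflection (fun k => triMoment G (jacobi 0 0 k)) =
      fun k => triMoment G ((jacobi 0 0 k).comp (1 - Polynomial.X)) := by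
  ext k
  refine (integral_const_mul _ _).symm.trans ?_
  rw [triMoment]
  congr 1 with p
  rw [Polynomial.eval_comp, Polynomial.eval_sub, Polynomial.eval_one, Polynomial.eval_X,
    eval_one_sub_jacobi]
  push_cast
  ring

/-- Row `m` holds the coefficients of `(1 - X) * jacobi 1 0 m` in the basis `jacobi 0 0`. Its degree
is at most `m + 1`, whence the range `m + 2`, and composing with `1 - X` turns the factor `1 - X`
into `X`. -/
theorem raising_triMoment {G : ℝ × ℝ → 𝕜} (hG : IntegrableOn G triangle) :
    raising (fun k => triMoment G ((jacobi 0 0 k).comp (1 - Polynomial.X))) =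
      fun k => triMoment G (Polynomial.X * (jacobi 1 0 k).comp (1 - Polynomial.X)) := by
  ext m
  rw [raising_apply, sum_mul_triMoment hG _
    (fun n => jacobiInner 1 0 (jacobi 1 0 m) (jacobi 0 0 n))]
  congr 1
  have hd : ((1 - Polynomial.X) * jacobi 1 0 m).natDegree ≤ m + 1 := by
    have h1 : (1 - Polynomial.X : Polynomial ℝ).natDegree ≤ 1 := by compute_degree
    have h2 := natDegree_jacobi_le 1 0 m
    have h3 := Polynomial.natDegree_mul_le (p := 1 - Polynomial.X) (q := jacobi 1 0 m)
    omega
  have h := congrArg (fun r => Polynomial.comp r (1 - Polynomial.X))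
    (eq_sum_jacobiInner_mul_jacobi 0 0 (m + 1) _ hd)
  simp only [Polynomial.mul_comp, Polynomial.sub_comp, Polynomial.one_comp, Polynomial.X_comp,
    sub_sub_cancel, Polynomial.sum_comp, Polynomial.C_comp] at h
  rw [h]
  simp only [jacobiInner_one_sub_X_mul]

theorem secondKindComposite_apply (K : ℝ → ℝ → 𝕜)
    (hK : IntegrableOn (fun p : ℝ × ℝ => K (1 - p.1) p.2) triangle) (v : ℕ →₀ 𝕜) (m : ℕ) :
    secondKindComposite K v m =
      ∫ p in triangle, K (1 - p.1) p.2 * jacobiSynthesis v p.2 *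
        ((p.1 * (jacobi 1 0 m).eval (1 - p.1) : ℝ) : 𝕜) := by
  set G : ℝ × ℝ → 𝕜 := fun p => K (1 - p.1) p.2 * jacobiSynthesis v p.2 with hG_def
  have hG : IntegrableOn G triangle := integrableOn_triangle_mul hK
    ((continuous_jacobiSynthesis v).comp continuous_snd)
  have h1 : integrateY (kernelCalculus (fun p => K (1 - p.1) p.2) (extendY 𝕜 v)) =
      fun k => triMoment G (jacobi 1 0 k) := by
    ext k
    refine (kernelCalculus_apply hK _ _).trans ?_
    rw [triMoment]
    congr 1 with p
    rw [triSynthesis_extendY, triBasis_zero_right]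
  have h2 : secondKindComposite K v = raising (reflection (lowering (integrateY
      (kernelCalculus (fun p => K (1 - p.1) p.2) (extendY 𝕜 v))))) := rfl
  rw [h2, h1, lowering_triMoment hG, reflection_triMoment, raising_triMoment hG]
  beta_reduce
  rw [triMoment]
  congr 1 with p
  simp [hG_def]

end Coefficients

/-! ### Hilbert–Schmidt operators and square integrable kernels. -/

section HilbertSchmidt

open Filter Topology ComplexConjugate

variable {𝕜 : Type*} [RCLike 𝕜]

/-- Hilbert–Schmidt operators are compact. -/
theorem isCompactOperator_of_summable_sq_norm {E F : Type*} [NormedAddCommGroup E]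
    [InnerProductSpace 𝕜 E] [NormedAddCommGroup F] [NormedSpace 𝕜 F] [CompleteSpace F]
    (b : HilbertBasis ℕ 𝕜 E) (T : E →L[𝕜] F) (hT : Summable fun n => ‖T (b n)‖ ^ 2) :
    IsCompactOperator T := by
  -- Finite-rank truncations of `T`. The tail is controlled by Cauchy–Schwarz, with Bessel's
  -- inequality for the coefficients of `x`, so the truncations converge to `T` in operator norm.
  set S : ℕ → E →L[𝕜] F := fun N =>
    ∑ n ∈ Finset.range N, (innerSL 𝕜 (b n)).smulRight (T (b n))
  have hS : ∀ N, IsCompactOperator (S N) := fun N => by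
    refine Finset.sum_induction (M := E →L[𝕜] F) _ (fun A : E →L[𝕜] F => IsCompactOperator A)
      (fun A B hA hB => hA.add hB) isCompactOperator_zero fun n _ => ?_
    have h1 : IsCompactOperator (id : 𝕜 → 𝕜) :=
      isCompactOperator_id_iff_locallyCompactSpace.mpr inferInstance
    exact (h1.clm_comp (ContinuousLinearMap.toSpanSingleton 𝕜 (T (b n)))).comp_clm (innerSL 𝕜 (b n))
  have hbound : ∀ N, ‖S N - T‖ ≤ √(∑' n, ‖T (b (n + N))‖ ^ 2) := fun N => by
    refine ContinuousLinearMap.opNorm_le_bound _ (Real.sqrt_nonneg _) fun x => ?_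
    have h1 : HasSum (fun n => b.repr x n • T (b n)) (T x) := by
      simpa using T.hasSum (b.hasSum_repr x)
    have h2 := (hasSum_nat_add_iff' N).mpr h1
    have h3 : T x - ∑ n ∈ Finset.range N, b.repr x n • T (b n) = -((S N - T) x) := by
      simp [S, HilbertBasis.repr_apply_apply]
    rw [h3] at h2
    rw [← norm_neg]
    refine le_of_tendsto h2.norm (Eventually.of_forall fun s => ?_)
    have hx := (b.orthonormal.comp (fun n => n + N) (add_left_injective N)).sum_inner_products_le
      x (s := s)
    have ht : ∑ n ∈ s, ‖T (b (n + N))‖ ^ 2 ≤ ∑' n, ‖T (b (n + N))‖ ^ 2 :=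
      ((summable_nat_add_iff (f := fun n => ‖T (b n)‖ ^ 2) N).mpr hT).sum_le_tsum s
        fun _ _ => sq_nonneg _
    calc ‖∑ n ∈ s, b.repr x (n + N) • T (b (n + N))‖
        ≤ ∑ n ∈ s, ‖b.repr x (n + N)‖ * ‖T (b (n + N))‖ :=
          (norm_sum_le _ _).trans (Finset.sum_le_sum fun n _ => norm_smul_le _ _)
      _ ≤ √(∑ n ∈ s, ‖b.repr x (n + N)‖ ^ 2) * √(∑ n ∈ s, ‖T (b (n + N))‖ ^ 2) :=
          Real.sum_mul_le_sqrt_mul_sqrt _ _ _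
      _ ≤ ‖x‖ * √(∑' n, ‖T (b (n + N))‖ ^ 2) := by
          refine mul_le_mul (Real.sqrt_le_iff.mpr ⟨norm_nonneg _, ?_⟩) (Real.sqrt_le_sqrt ht)
            (Real.sqrt_nonneg _) (norm_nonneg _)
          simpa [HilbertBasis.repr_apply_apply] using hx
      _ = _ := mul_comm _ _
  refine isCompactOperator_of_tendsto (l := atTop) (F := S) ?_ (Eventually.of_forall hS)
  rw [tendsto_iff_norm_sub_tendsto_zero]
  refine squeeze_zero (fun _ => norm_nonneg _) hbound ?_
  have := (Real.continuous_sqrt.tendsto 0).comp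
    (tendsto_sum_nat_add fun n => ‖T (b n)‖ ^ 2)
  rwa [Real.sqrt_zero] at this

variable {α : Type*} [MeasurableSpace α] {μ : Measure α}

theorem sq_norm_Lp_two (u : Lp 𝕜 2 μ) : ‖u‖ ^ 2 = ∫ x, ‖u x‖ ^ 2 ∂μ := by
  have h := inner_self_eq_norm_sq_to_K (𝕜 := 𝕜) u
  rw [L2.inner_def] at h
  simp only [inner_self_eq_norm_sq_to_K, ← RCLike.ofReal_pow] at h
  rw [integral_ofReal, RCLike.ofReal_inj] at h
  exact h.symm

theorem sq_norm_toLp_two {f : α → 𝕜} (hf : MemLp f 2 μ) :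
    ‖hf.toLp f‖ ^ 2 = ∫ x, ‖f x‖ ^ 2 ∂μ := by
  rw [sq_norm_Lp_two]
  refine integral_congr_ae ?_
  filter_upwards [hf.coeFn_toLp] with x hx
  rw [hx]

/-- The Riesz representative of `u ↦ ∫ f u`. -/
theorem exists_inner_eq_integral_mul {f : α → 𝕜} (hf : MemLp f 2 μ) :
    ∃ κ : Lp 𝕜 2 μ, ‖κ‖ ^ 2 = ∫ y, ‖f y‖ ^ 2 ∂μ ∧
      ∀ u : Lp 𝕜 2 μ, ∫ y, f y * u y ∂μ = inner 𝕜 κ u := by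
  -- The inner product is conjugate-linear in its first argument, so the representative is the
  -- conjugate of `f`.
  have hf' : MemLp (fun y => conj (f y)) 2 μ := hf.star
  refine ⟨hf'.toLp _, ?_, fun u => ?_⟩
  · rw [sq_norm_toLp_two]
    simp only [RCLike.norm_conj]
  · rw [L2.inner_def]
    refine integral_congr_ae ?_
    filter_upwards [hf'.coeFn_toLp] with y hy
    rw [hy, RCLike.inner_apply, RCLike.conj_conj, mul_comm]

section IntegralOperator

variable [SFinite μ] {k : α → α → 𝕜}

theorem ae_memLp_of_memLp_prod (hk : MemLp (fun p : α × α => k p.1 p.2) 2 (μ.prod μ)) :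
    ∀ᵐ x ∂μ, MemLp (k x) 2 μ := by
  have h := (memLp_two_iff_integrable_sq_norm hk.1).mp hk
  filter_upwards [h.prod_right_ae, hk.1.prodMk_left] with x hx hx'
  exact (memLp_two_iff_integrable_sq_norm hx').mpr hx

theorem ae_integrable_kernel_mul (hk : MemLp (fun p : α × α => k p.1 p.2) 2 (μ.prod μ))
    (u : Lp 𝕜 2 μ) : ∀ᵐ x ∂μ, Integrable (fun y => k x y * u y) μ := by
  filter_upwards [ae_memLp_of_memLp_prod hk] with x hx
  exact hx.integrable_mul (Lp.memLp u)

/-- The exceptional null set does not depend on `u`. Linearity, Cauchy–Schwarz and Bessel can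
therefore be applied slice by slice to several `u` at once. -/
theorem ae_exists_inner_eq_integral_kernel_mul
    (hk : MemLp (fun p : α × α => k p.1 p.2) 2 (μ.prod μ)) :
    ∀ᵐ x ∂μ, ∃ κ : Lp 𝕜 2 μ, ‖κ‖ ^ 2 = ∫ y, ‖k x y‖ ^ 2 ∂μ ∧
      ∀ u : Lp 𝕜 2 μ, ∫ y, k x y * u y ∂μ = inner 𝕜 κ u := by
  filter_upwards [ae_memLp_of_memLp_prod hk] with x hx
  exact exists_inner_eq_integral_mul hx

theorem integrable_integral_sq_norm_kernel
    (hk : MemLp (fun p : α × α => k p.1 p.2) 2 (μ.prod μ)) :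
    Integrable (fun x => ∫ y, ‖k x y‖ ^ 2 ∂μ) μ :=
  ((memLp_two_iff_integrable_sq_norm hk.1).mp hk).integral_prod_left

theorem memLp_integral_kernel_mul (hk : MemLp (fun p : α × α => k p.1 p.2) 2 (μ.prod μ))
    (u : Lp 𝕜 2 μ) : MemLp (fun x => ∫ y, k x y * u y ∂μ) 2 μ := by
  have hm : AEStronglyMeasurable (fun x => ∫ y, k x y * u y ∂μ) μ :=
    (hk.1.mul (Lp.memLp u).1.comp_snd).integral_prod_right'
  refine (memLp_two_iff_integrable_sq_norm hm).mpr
    (((integrable_integral_sq_norm_kernel hk).mul_const (‖u‖ ^ 2)).mono' (hm.norm.pow 2) ?_)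
  filter_upwards [ae_exists_inner_eq_integral_kernel_mul hk] with x ⟨κ, hκ, hu⟩
  rw [hu, ← hκ, ← mul_pow, Real.norm_of_nonneg (sq_nonneg _)]
  exact pow_le_pow_left₀ (norm_nonneg _) (norm_inner_le_norm _ _) 2

/-- The integral operator on `L²(μ)` with a square integrable kernel. -/
noncomputable def integralOperator (hk : MemLp (fun p : α × α => k p.1 p.2) 2 (μ.prod μ)) :
    Lp 𝕜 2 μ →L[𝕜] Lp 𝕜 2 μ :=
  LinearMap.mkContinuous
    { toFun := fun u => (memLp_integral_kernel_mul hk u).toLp _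
      map_add' := fun u v => by
        rw [← MemLp.toLp_add, MemLp.toLp_eq_toLp_iff]
        filter_upwards [ae_exists_inner_eq_integral_kernel_mul hk] with x ⟨κ, _, hκ⟩
        simp only [Pi.add_apply, hκ, inner_add_right]
      map_smul' := fun c u => by
        rw [RingHom.id_apply, ← MemLp.toLp_const_smul, MemLp.toLp_eq_toLp_iff]
        filter_upwards [ae_exists_inner_eq_integral_kernel_mul hk] with x ⟨κ, _, hκ⟩
        simp only [Pi.smul_apply, hκ, inner_smul_right, smul_eq_mul] }
    -- The bound is the Hilbert–Schmidt norm of the kernel, from Cauchy–Schwarz in `y` for each `x`.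
    (√(∫ x, ∫ y, ‖k x y‖ ^ 2 ∂μ ∂μ)) fun u => by
      refine abs_le_of_sq_le_sq' ?_ (by positivity) |>.2
      rw [LinearMap.coe_mk, AddHom.coe_mk, sq_norm_toLp_two, mul_pow, Real.sq_sqrt
        (integral_nonneg fun x => integral_nonneg fun y => sq_nonneg _), ← integral_mul_const]
      refine integral_mono_ae ((memLp_two_iff_integrable_sq_norm
        (memLp_integral_kernel_mul hk u).1).mp (memLp_integral_kernel_mul hk u))
        ((integrable_integral_sq_norm_kernel hk).mul_const _) ?_
      filter_upwards [ae_exists_inner_eq_integral_kernel_mul hk] with x ⟨κ, hκ, hu⟩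
      rw [hu, ← hκ, ← mul_pow]
      exact pow_le_pow_left₀ (norm_nonneg _) (norm_inner_le_norm _ _) 2

theorem coeFn_integralOperator (hk : MemLp (fun p : α × α => k p.1 p.2) 2 (μ.prod μ))
    (u : Lp 𝕜 2 μ) : integralOperator hk u =ᵐ[μ] fun x => ∫ y, k x y * u y ∂μ :=
  (memLp_integral_kernel_mul hk u).coeFn_toLp

/-- For almost every `x`, Bessel's inequality for the slice `k x` bounds `∑ |(V b_n)(x)|²` by `∫
|k(x,y)|² dy`. Integrating in `x` bounds every partial sum of `∑ ‖V b_n‖²`. -/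
theorem isCompactOperator_integralOperator
    (hk : MemLp (fun p : α × α => k p.1 p.2) 2 (μ.prod μ)) (b : HilbertBasis ℕ 𝕜 (Lp 𝕜 2 μ)) :
    IsCompactOperator (integralOperator hk) := by
  refine isCompactOperator_of_summable_sq_norm b _ (summable_of_sum_le
    (c := ∫ x, ∫ y, ‖k x y‖ ^ 2 ∂μ ∂μ) (fun _ => sq_nonneg _) fun s => ?_)
  have hnorm : ∀ n, ‖integralOperator hk (b n)‖ ^ 2 = ∫ x, ‖∫ y, k x y * b n y ∂μ‖ ^ 2 ∂μ :=
    fun n => sq_norm_toLp_two (memLp_integral_kernel_mul hk (b n))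
  have hint : ∀ n, Integrable (fun x => ‖∫ y, k x y * b n y ∂μ‖ ^ 2) μ := fun n =>
    (memLp_two_iff_integrable_sq_norm (memLp_integral_kernel_mul hk (b n)).1).mp
      (memLp_integral_kernel_mul hk (b n))
  simp only [hnorm]
  rw [← integral_finsetSum _ fun n _ => hint n]
  refine integral_mono_ae (integrable_finsetSum _ fun n _ => hint n)
    (integrable_integral_sq_norm_kernel hk) ?_
  filter_upwards [ae_exists_inner_eq_integral_kernel_mul hk] with x ⟨κ, hκ, hu⟩
  simp only [hu, ← hκ]
  simp only [norm_inner_symm κ]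
  exact b.orthonormal.sum_inner_products_le κ

end IntegralOperator

end HilbertSchmidt

/-! ### The weighted space, its Jacobi basis, and the Volterra kernel. -/

section WeightedSpace

open Filter Topology ComplexConjugate

instance : IsFiniteMeasure jacobiMeasure := by
  refine isFiniteMeasure_withDensity (ne_of_lt ?_)
  calc ∫⁻ x in Set.Ioo (0 : ℝ) 1, ENNReal.ofReal (1 - x)
      ≤ ∫⁻ _ in Set.Ioo (0 : ℝ) 1, 1 := by
        refine setLIntegral_mono measurable_const fun x hx => ?_
        rw [← ENNReal.ofReal_one]
        exact ENNReal.ofReal_le_ofReal (by linarith [hx.1])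
    _ < ⊤ := by simp

theorem measurable_jacobiWeight : Measurable fun x : ℝ => ENNReal.ofReal (1 - x) := by fun_prop

theorem jacobiMeasure_absolutelyContinuous :
    jacobiMeasure ≪ volume.restrict (Set.Ioo (0 : ℝ) 1) :=
  withDensity_absolutelyContinuous _ _

theorem ae_mem_Ioo_jacobiMeasure : ∀ᵐ x ∂jacobiMeasure, x ∈ Set.Ioo (0 : ℝ) 1 :=
  jacobiMeasure_absolutelyContinuous.ae_le (ae_restrict_mem measurableSet_Ioo)

theorem integral_jacobiMeasure {E : Type*} [NormedAddCommGroup E] [NormedSpace ℝ E] (f : ℝ → E) :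
    ∫ x, f x ∂jacobiMeasure = ∫ x in Set.Ioo (0 : ℝ) 1, (1 - x) • f x := by
  rw [jacobiMeasure, integral_withDensity_eq_integral_toReal_smul measurable_jacobiWeight
    (by simp)]
  refine setIntegral_congr_fun measurableSet_Ioo fun x hx => ?_
  rw [ENNReal.toReal_ofReal (by linarith [hx.2])]

theorem integrable_jacobiMeasure_iff {E : Type*} [NormedAddCommGroup E] [NormedSpace ℝ E]
    {f : ℝ → E} :
    Integrable f jacobiMeasure ↔ IntegrableOn (fun x => (1 - x) • f x) (Set.Ioo (0 : ℝ) 1) := by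
  rw [jacobiMeasure, integrable_withDensity_iff_integrable_smul' measurable_jacobiWeight
    (by simp)]
  refine integrableOn_congr_fun (fun x hx => ?_) measurableSet_Ioo
  rw [ENNReal.toReal_ofReal (by linarith [hx.2])]

variable {𝕜 : Type*} [RCLike 𝕜]

theorem memLp_jacobiMeasure {f : ℝ → 𝕜} (hf : Continuous f) : MemLp f 2 jacobiMeasure := by
  obtain ⟨c, hc⟩ := (isCompact_Icc (a := (0 : ℝ)) (b := 1)).exists_bound_of_continuousOn
    hf.continuousOn
  refine MemLp.of_bound hf.aestronglyMeasurable c ?_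
  filter_upwards [ae_mem_Ioo_jacobiMeasure] with x hx
  exact hc x ⟨hx.1.le, hx.2.le⟩

theorem continuous_ofReal_eval (p : Polynomial ℝ) : Continuous fun x => ((p.eval x : ℝ) : 𝕜) :=
  RCLike.continuous_ofReal.comp p.continuous

variable (𝕜) in
/-- A real polynomial as an element of `L²((0,1), (1-x) dx)`. -/
noncomputable def polynomialLp (p : Polynomial ℝ) : Lp 𝕜 2 jacobiMeasure :=
  (memLp_jacobiMeasure (continuous_ofReal_eval p)).toLp _

theorem coeFn_polynomialLp (p : Polynomial ℝ) :
    polynomialLp 𝕜 p =ᵐ[jacobiMeasure] fun x => ((p.eval x : ℝ) : 𝕜) :=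
  MemLp.coeFn_toLp _

theorem inner_polynomialLp (p : Polynomial ℝ) (u : Lp 𝕜 2 jacobiMeasure) :
    inner 𝕜 (polynomialLp 𝕜 p) u = ∫ x, ((p.eval x : ℝ) : 𝕜) * u x ∂jacobiMeasure := by
  rw [L2.inner_def]
  refine integral_congr_ae ?_
  filter_upwards [coeFn_polynomialLp (𝕜 := 𝕜) p] with x hx
  rw [hx, RCLike.inner_apply, RCLike.conj_ofReal, mul_comm]

theorem inner_polynomialLp_polynomialLp (p q : Polynomial ℝ) :
    inner 𝕜 (polynomialLp 𝕜 p) (polynomialLp 𝕜 q) = ((jacobiInner 1 0 p q : ℝ) : 𝕜) := by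
  have h : ∫ x, ((p.eval x : ℝ) : 𝕜) * polynomialLp 𝕜 q x ∂jacobiMeasure =
      ∫ x, ((p.eval x * q.eval x : ℝ) : 𝕜) ∂jacobiMeasure := by
    refine integral_congr_ae ?_
    filter_upwards [coeFn_polynomialLp (𝕜 := 𝕜) q] with x hx
    rw [hx, RCLike.ofReal_mul]
  rw [inner_polynomialLp, h, integral_ofReal, integral_jacobiMeasure, jacobiInner,
    intervalIntegral.integral_of_le zero_le_one, integral_Ioc_eq_integral_Ioo]
  congr 2 with x
  simp only [smul_eq_mul, pow_one, pow_zero, mul_one]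
  ring

theorem orthonormal_polynomialLp_jacobi :
    Orthonormal 𝕜 fun n => polynomialLp 𝕜 (jacobi 1 0 n) := by
  rw [orthonormal_iff_ite]
  intro m n
  rw [inner_polynomialLp_polynomialLp, jacobiInner_jacobi]
  split_ifs <;> simp

theorem polynomialLp_sum (s : Finset ℕ) (c : ℕ → ℝ) (p : ℕ → Polynomial ℝ) :
    polynomialLp 𝕜 (∑ n ∈ s, Polynomial.C (c n) * p n) =
      ∑ n ∈ s, (c n : 𝕜) • polynomialLp 𝕜 (p n) := by
  refine Lp.ext ?_
  have h1 : ∀ n ∈ s, ((c n : 𝕜) • polynomialLp 𝕜 (p n) : Lp 𝕜 2 jacobiMeasure) =ᵐ[jacobiMeasure]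
      fun x => (c n : 𝕜) * (((p n).eval x : ℝ) : 𝕜) := fun n _ => by
    filter_upwards [Lp.coeFn_smul (c n : 𝕜) (polynomialLp 𝕜 (p n)), coeFn_polynomialLp (𝕜 := 𝕜) (p n)]
      with x hx hx'
    rw [hx, Pi.smul_apply, hx', smul_eq_mul]
  filter_upwards [coeFn_polynomialLp (𝕜 := 𝕜) (∑ n ∈ s, Polynomial.C (c n) * p n),
    Lp.coeFn_finsetSum s fun n => (c n : 𝕜) • polynomialLp 𝕜 (p n),
    (Finset.eventually_all s).mpr h1] with x hx hx' h
  rw [hx, hx', Finset.sum_apply, Finset.sum_congr rfl h, Polynomial.eval_finsetSum]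
  push_cast
  refine Finset.sum_congr rfl fun n _ => ?_
  rw [Polynomial.eval_mul, Polynomial.eval_C]
  push_cast
  rfl

theorem polynomialLp_mem_span (p : Polynomial ℝ) :
    polynomialLp 𝕜 p ∈ Submodule.span 𝕜 (Set.range fun n => polynomialLp 𝕜 (jacobi 1 0 n)) := by
  rw [eq_sum_jacobiInner_mul_jacobi 1 0 _ p le_rfl, polynomialLp_sum]
  exact Submodule.sum_mem _ fun n _ => Submodule.smul_mem _ _ (Submodule.subset_span ⟨n, rfl⟩)

/-- Bounded continuous functions are dense in `L²` of this finite measure; Weierstrass approximates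
their real and imaginary parts uniformly on `[0,1]`. -/
theorem span_polynomialLp_jacobi_dense :
    ⊤ ≤ (Submodule.span 𝕜
      (Set.range fun n => polynomialLp 𝕜 (jacobi 1 0 n))).topologicalClosure := by
  set W := Submodule.span 𝕜 (Set.range fun n => polynomialLp 𝕜 (jacobi 1 0 n))
  rintro u -
  refine (BoundedContinuousFunction.toLp_denseRange (α := ℝ) (E := 𝕜) (p := 2) jacobiMeasure 𝕜
    (by simp)).induction_on u W.isClosed_topologicalClosure fun g => ?_
  refine Metric.mem_closure_iff.mpr fun ε hε => ?_
  set M : ℝ := (measureUnivNNReal jacobiMeasure : ℝ) ^ ((2 : ENNReal).toReal)⁻¹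
  have hM : 0 ≤ M := by positivity
  -- A uniform error `2 * δ` costs at most `M * (2 * δ)` in norm; `M + 1` keeps the denominator
  -- positive and the final inequality strict.
  set δ : ℝ := ε / (2 * (M + 1))
  have hδ : 0 < δ := by positivity
  obtain ⟨p, hp⟩ := exists_polynomial_near_of_continuousOn 0 1 (fun x => RCLike.re (g x))
    (RCLike.continuous_re.comp g.continuous).continuousOn δ hδ
  obtain ⟨q, hq⟩ := exists_polynomial_near_of_continuousOn 0 1 (fun x => RCLike.im (g x))
    (RCLike.continuous_im.comp g.continuous).continuousOn δ hδ
  refine ⟨polynomialLp 𝕜 p + (RCLike.I : 𝕜) • polynomialLp 𝕜 q,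
    W.add_mem (polynomialLp_mem_span p) (W.smul_mem _ (polynomialLp_mem_span q)), ?_⟩
  rw [dist_eq_norm]
  have hae : ∀ᵐ x ∂jacobiMeasure, ‖(BoundedContinuousFunction.toLp 2 jacobiMeasure 𝕜 g -
      (polynomialLp 𝕜 p + (RCLike.I : 𝕜) • polynomialLp 𝕜 q) : Lp 𝕜 2 jacobiMeasure) x‖ ≤
        2 * δ := by
    filter_upwards [ae_mem_Ioo_jacobiMeasure, coeFn_polynomialLp (𝕜 := 𝕜) p,
      coeFn_polynomialLp (𝕜 := 𝕜) q, BoundedContinuousFunction.coeFn_toLp 2 jacobiMeasure 𝕜 g,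
      Lp.coeFn_sub (BoundedContinuousFunction.toLp 2 jacobiMeasure 𝕜 g)
        (polynomialLp 𝕜 p + (RCLike.I : 𝕜) • polynomialLp 𝕜 q),
      Lp.coeFn_add (polynomialLp 𝕜 p) ((RCLike.I : 𝕜) • polynomialLp 𝕜 q),
      Lp.coeFn_smul (RCLike.I : 𝕜) (polynomialLp 𝕜 q)] with x hx h1 h2 h3 h4 h5 h6
    have hx' : x ∈ Set.Icc (0 : ℝ) 1 := ⟨hx.1.le, hx.2.le⟩
    rw [h4, Pi.sub_apply, h5, Pi.add_apply, h6, Pi.smul_apply, h1, h2, h3, smul_eq_mul]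
    have e : g x - (((p.eval x : ℝ) : 𝕜) + RCLike.I * ((q.eval x : ℝ) : 𝕜)) =
        -(((p.eval x - RCLike.re (g x) : ℝ) : 𝕜) +
          ((q.eval x - RCLike.im (g x) : ℝ) : 𝕜) * RCLike.I) := by
      conv_lhs => rw [← RCLike.re_add_im (g x)]
      push_cast
      ring
    rw [e, norm_neg]
    refine (norm_add_le _ _).trans ?_
    rw [norm_mul, RCLike.norm_ofReal, RCLike.norm_ofReal, two_mul]
    refine add_le_add (hp x hx').le ?_
    -- In the real case `RCLike.I` is `0`, so only an inequality holds uniformly in `𝕜`.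
    have hI : ‖(RCLike.I : 𝕜)‖ ≤ 1 := by
      by_cases h0 : (RCLike.I : 𝕜) = 0
      · simp [h0]
      · exact (RCLike.norm_I_of_ne_zero h0).le
    exact (mul_le_of_le_one_right (abs_nonneg _) hI).trans (hq x hx').le
  refine (Lp.norm_le_of_ae_bound (by positivity) hae).trans_lt ?_
  show M * (2 * δ) < ε
  have : M * (2 * δ) = ε * (M / (M + 1)) := by
    simp only [δ]
    field_simp
  rw [this]
  exact mul_lt_of_lt_one_right hε ((div_lt_one (by positivity)).mpr (by linarith))

variable (𝕜) in
/-- The orthonormal basis `P̃^{(1,0)}` of `L²((0,1), (1-x) dx)`. -/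
noncomputable def jacobiHilbertBasis : HilbertBasis ℕ 𝕜 (Lp 𝕜 2 jacobiMeasure) :=
  HilbertBasis.mk orthonormal_polynomialLp_jacobi span_polynomialLp_jacobi_dense

theorem jacobiHilbertBasis_apply (n : ℕ) :
    jacobiHilbertBasis 𝕜 n = polynomialLp 𝕜 (jacobi 1 0 n) := by
  rw [jacobiHilbertBasis, HilbertBasis.coe_mk]

theorem jacobiHilbertBasis_repr_apply (u : Lp 𝕜 2 jacobiMeasure) (n : ℕ) :
    (jacobiHilbertBasis 𝕜).repr u n =
      ∫ x, (((jacobi 1 0 n).eval x : ℝ) : 𝕜) * u x ∂jacobiMeasure := by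
  rw [HilbertBasis.repr_apply_apply, jacobiHilbertBasis_apply, inner_polynomialLp]

theorem coeFn_linearCombination_jacobiHilbertBasis (v : ℕ →₀ 𝕜) :
    Finsupp.linearCombination 𝕜 (jacobiHilbertBasis 𝕜) v =ᵐ[jacobiMeasure] jacobiSynthesis v := by
  induction v using Finsupp.induction_linear with
  | zero =>
    rw [map_zero]
    filter_upwards [Lp.coeFn_zero 𝕜 2 jacobiMeasure] with x hx
    rw [hx, jacobiSynthesis, Finsupp.sum_zero_index, Pi.zero_apply]
  | add v w hv hw =>
    rw [map_add]
    filter_upwards [hv, hw, Lp.coeFn_add (Finsupp.linearCombination 𝕜 (jacobiHilbertBasis 𝕜) v)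
      (Finsupp.linearCombination 𝕜 (jacobiHilbertBasis 𝕜) w)] with x hx hx' h
    rw [h, Pi.add_apply, hx, hx', jacobiSynthesis, jacobiSynthesis, jacobiSynthesis,
      Finsupp.sum_add_index' (by simp) (by simp [add_mul])]
  | single n c =>
    rw [Finsupp.linearCombination_single, jacobiHilbertBasis_apply]
    filter_upwards [Lp.coeFn_smul c (polynomialLp 𝕜 (jacobi 1 0 n)),
      coeFn_polynomialLp (𝕜 := 𝕜) (jacobi 1 0 n)] with x hx hx'
    rw [hx, Pi.smul_apply, hx', jacobiSynthesis, Finsupp.sum_single_index (by simp), smul_eq_mul]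

/-- The kernel of the Volterra operator with respect to the measure `(1-y) dy`. -/
noncomputable def volterraKernel (K : ℝ → ℝ → 𝕜) (x y : ℝ) : 𝕜 :=
  (1 - y)⁻¹ • Set.indicator {p : ℝ × ℝ | 0 ≤ p.2 ∧ p.2 ≤ p.1 ∧ p.1 ≤ 1} (fun p => K p.1 p.2) (x, y)

theorem measurableSet_volterra :
    MeasurableSet {p : ℝ × ℝ | 0 ≤ p.2 ∧ p.2 ≤ p.1 ∧ p.1 ≤ 1} :=
  (measurableSet_le measurable_const measurable_snd).inter
    ((measurableSet_le measurable_snd measurable_fst).inter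
      (measurableSet_le measurable_fst measurable_const))

theorem jacobiMeasure_prod : jacobiMeasure.prod jacobiMeasure =
    (volume.restrict (Set.Ioo (0 : ℝ) 1 ×ˢ Set.Ioo (0 : ℝ) 1)).withDensity
      fun p => ENNReal.ofReal (1 - p.1) * ENNReal.ofReal (1 - p.2) := by
  rw [jacobiMeasure, prod_withDensity measurable_jacobiWeight measurable_jacobiWeight,
    Measure.prod_restrict, Measure.volume_eq_prod]

/-- The product weight `(1-x)(1-y)` times `|K|²/(1-y)²` equals `|K|² (1-x)/(1-y)`, and the quotient
is at most `1` on the support `y ≤ x`. The singularity of the kernel at `y = 1` is thus harmless. -/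
theorem memLp_volterraKernel {K : ℝ → ℝ → 𝕜} (hK : MemLp (fun p : ℝ × ℝ => K p.1 p.2) 2
      (volume.restrict {p : ℝ × ℝ | 0 ≤ p.2 ∧ p.2 ≤ p.1 ∧ p.1 ≤ 1})) :
    MemLp (fun p : ℝ × ℝ => volterraKernel K p.1 p.2) 2 (jacobiMeasure.prod jacobiMeasure) := by
  set S : Set (ℝ × ℝ) := {p : ℝ × ℝ | 0 ≤ p.2 ∧ p.2 ≤ p.1 ∧ p.1 ≤ 1} with hS
  have hm : AEStronglyMeasurable (S.indicator fun p : ℝ × ℝ => K p.1 p.2) volume :=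
    (aestronglyMeasurable_indicator_iff measurableSet_volterra).mpr hK.1
  have hm' : AEStronglyMeasurable (fun p : ℝ × ℝ => volterraKernel K p.1 p.2) volume :=
    (by fun_prop : Measurable fun p : ℝ × ℝ => (1 - p.2)⁻¹).aestronglyMeasurable.smul hm
  have hac : jacobiMeasure.prod jacobiMeasure ≪ (volume : Measure (ℝ × ℝ)) := by
    rw [jacobiMeasure_prod]
    exact (withDensity_absolutelyContinuous _ _).trans Measure.restrict_le_self.absolutelyContinuous
  refine (memLp_two_iff_integrable_sq_norm (hm'.mono_ac hac)).mpr ?_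
  have hint : Integrable (S.indicator fun p : ℝ × ℝ => ‖K p.1 p.2‖ ^ 2) volume :=
    (integrable_indicator_iff measurableSet_volterra).mpr
      ((memLp_two_iff_integrable_sq_norm hK.1).mp hK)
  rw [jacobiMeasure_prod, integrable_withDensity_iff_integrable_smul' (by fun_prop)
    (Eventually.of_forall fun p => ENNReal.mul_lt_top ENNReal.ofReal_lt_top ENNReal.ofReal_lt_top)]
  refine (hint.restrict (s := Set.Ioo (0 : ℝ) 1 ×ˢ Set.Ioo (0 : ℝ) 1)).mono' ?_ ?_
  · exact ((by fun_prop : Measurable fun p : ℝ × ℝ => (ENNReal.ofReal (1 - p.1) *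
      ENNReal.ofReal (1 - p.2)).toReal).aestronglyMeasurable.smul (hm'.norm.pow 2)).restrict
  · filter_upwards [ae_restrict_mem (measurableSet_Ioo.prod measurableSet_Ioo)] with p hp
    have h1 : 0 < 1 - p.1 := sub_pos.mpr hp.1.2
    have h2 : 0 < 1 - p.2 := sub_pos.mpr hp.2.2
    rw [ENNReal.toReal_mul, ENNReal.toReal_ofReal h1.le, ENNReal.toReal_ofReal h2.le, smul_eq_mul,
      Real.norm_of_nonneg (by positivity), volterraKernel, norm_smul, norm_inv,
      Real.norm_of_nonneg h2.le]
    by_cases hpS : p ∈ S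
    · rw [Set.indicator_of_mem hpS, Set.indicator_of_mem (show (p.1, p.2) ∈ S from hpS)]
      have h3 : (1 - p.1) / (1 - p.2) ≤ 1 := (div_le_one h2).mpr (by linarith [hpS.2.1])
      calc (1 - p.1) * (1 - p.2) * ((1 - p.2)⁻¹ * ‖K p.1 p.2‖) ^ 2
          = (1 - p.1) / (1 - p.2) * ‖K p.1 p.2‖ ^ 2 := by field_simp
        _ ≤ ‖K p.1 p.2‖ ^ 2 := mul_le_of_le_one_left (sq_nonneg _) h3
    · rw [Set.indicator_of_notMem hpS, Set.indicator_of_notMem (show (p.1, p.2) ∉ S from hpS)]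
      simp

theorem smul_volterraKernel_mul (K : ℝ → ℝ → 𝕜) (u : ℝ → 𝕜) {x y : ℝ}
    (hx : x ∈ Set.Ioo (0 : ℝ) 1) (hy : y ∈ Set.Ioo (0 : ℝ) 1) :
    (1 - y) • (volterraKernel K x y * u y) =
      (Set.Iic x).indicator (fun y => K x y * u y) y := by
  have h : 1 - y ≠ 0 := (sub_pos.mpr hy.2).ne'
  rw [volterraKernel, smul_mul_assoc, smul_smul, mul_inv_cancel₀ h, one_smul]
  by_cases hyx : y ≤ x
  · rw [Set.indicator_of_mem (show (x, y) ∈ {p : ℝ × ℝ | 0 ≤ p.2 ∧ p.2 ≤ p.1 ∧ p.1 ≤ 1} from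
      ⟨hy.1.le, hyx, hx.2.le⟩), Set.indicator_of_mem (Set.mem_Iic.mpr hyx)]
  · rw [Set.indicator_of_notMem (fun h => hyx h.2.1), Set.indicator_of_notMem (show y ∉ Set.Iic x from hyx), zero_mul]

theorem Ioo_inter_Iic {x : ℝ} (hx : x ∈ Set.Ioo (0 : ℝ) 1) :
    Set.Ioo (0 : ℝ) 1 ∩ Set.Iic x = Set.Ioc 0 x := by
  ext y
  exact ⟨fun h => ⟨h.1.1, h.2⟩, fun h => ⟨⟨h.1, h.2.trans_lt hx.2⟩, h.2⟩⟩

theorem integral_volterraKernel_mul (K : ℝ → ℝ → 𝕜) (u : ℝ → 𝕜) {x : ℝ}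
    (hx : x ∈ Set.Ioo (0 : ℝ) 1) :
    ∫ y, volterraKernel K x y * u y ∂jacobiMeasure = ∫ y in (0 : ℝ)..x, K x y * u y := by
  rw [integral_jacobiMeasure, setIntegral_congr_fun measurableSet_Ioo fun y hy =>
    smul_volterraKernel_mul K u hx hy, setIntegral_indicator measurableSet_Iic, Ioo_inter_Iic hx,
    intervalIntegral.integral_of_le hx.1.le]

theorem intervalIntegrable_of_integrable_volterraKernel_mul {K : ℝ → ℝ → 𝕜} {u : ℝ → 𝕜} {x : ℝ}
    (hx : x ∈ Set.Ioo (0 : ℝ) 1)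
    (h : Integrable (fun y => volterraKernel K x y * u y) jacobiMeasure) :
    IntervalIntegrable (fun y => K x y * u y) volume 0 x := by
  rw [integrable_jacobiMeasure_iff, integrableOn_congr_fun (fun y hy =>
    smul_volterraKernel_mul K u hx hy) measurableSet_Ioo,
    integrableOn_indicator_iff measurableSet_Iic, Set.inter_comm, Ioo_inter_Iic hx] at h
  exact (intervalIntegrable_iff_integrableOn_Ioc_of_le hx.1.le).mpr h

/-- On a set of finite measure `L²` embeds in `L¹`, and `x ↦ 1 - x` carries one triangle to the
other preserving measure. Integrability is all that the matrix computation needs. -/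
theorem integrableOn_triangle_reflected {K : ℝ → ℝ → 𝕜} (hK : MemLp (fun p : ℝ × ℝ => K p.1 p.2) 2
      (volume.restrict {p : ℝ × ℝ | 0 ≤ p.2 ∧ p.2 ≤ p.1 ∧ p.1 ≤ 1})) :
    IntegrableOn (fun p : ℝ × ℝ => K (1 - p.1) p.2) triangle := by
  set S : Set (ℝ × ℝ) := {p : ℝ × ℝ | 0 ≤ p.2 ∧ p.2 ≤ p.1 ∧ p.1 ≤ 1} with hS
  have hfin : IsFiniteMeasure (volume.restrict S) := by
    refine ⟨?_⟩
    rw [Measure.restrict_apply_univ]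
    refine (measure_mono ?_).trans_lt
      (isCompact_Icc (a := ((0 : ℝ), (0 : ℝ))) (b := (1, 1))).measure_lt_top
    rintro ⟨x, y⟩ ⟨h1, h2, h3⟩
    simp only at h1 h2 h3
    exact ⟨⟨h1.trans h2, h1⟩, ⟨h3, h2.trans h3⟩⟩
  have hKS : IntegrableOn (fun p : ℝ × ℝ => K p.1 p.2) S := hK.integrable one_le_two
  let e : ℝ × ℝ ≃ᵐ ℝ × ℝ := (MeasurableEquiv.subLeft (1 : ℝ)).prodCongr (MeasurableEquiv.refl ℝ)
  have he : MeasurePreserving e volume volume :=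
    (Measure.measurePreserving_sub_left volume (1 : ℝ)).prod (MeasurePreserving.id volume)
  have h := (he.integrableOn_comp_preimage e.measurableEmbedding).mpr hKS
  have hpre : e ⁻¹' S = triangle := by
    ext p
    constructor
    · rintro ⟨h1, h2, h3⟩
      have h3' : 1 - p.1 ≤ 1 := h3
      exact ⟨by linarith, h1, h2⟩
    · rintro ⟨h1, h2, h3⟩
      exact ⟨h2, h3, show 1 - p.1 ≤ 1 by linarith⟩
  rwa [hpre] at h

end WeightedSpace

/-! ### The composite as the matrix of the Volterra operator. -/

section SecondKind

variable {𝕜 : Type*} [RCLike 𝕜]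

/-- Fubini on the triangle followed by `x ↦ 1 - x`: the factor `x` produced by `raising` becomes the
weight `1 - x`, and the inner range `[0, 1-x]` becomes `[0, x]`. -/
theorem secondKindComposite_eq_integral {K : ℝ → ℝ → 𝕜}
    (hK : MemLp (fun p : ℝ × ℝ => K p.1 p.2) 2
      (volume.restrict {p : ℝ × ℝ | 0 ≤ p.2 ∧ p.2 ≤ p.1 ∧ p.1 ≤ 1})) (v : ℕ →₀ 𝕜) (m : ℕ) :
    secondKindComposite K v m = ∫ x, (((jacobi 1 0 m).eval x : ℝ) : 𝕜) *
      ∫ y, volterraKernel K x y * jacobiSynthesis v y ∂jacobiMeasure ∂jacobiMeasure := by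
  have hint := integrableOn_triangle_reflected hK
  set f : ℝ → 𝕜 := fun x => (((1 - x) * (jacobi 1 0 m).eval x : ℝ) : 𝕜) *
    ∫ y in (0 : ℝ)..x, K x y * jacobiSynthesis v y with hf
  have hR : ∫ x, (((jacobi 1 0 m).eval x : ℝ) : 𝕜) *
      ∫ y, volterraKernel K x y * jacobiSynthesis v y ∂jacobiMeasure ∂jacobiMeasure =
      ∫ x in (0 : ℝ)..1, f x := by
    rw [integral_jacobiMeasure, intervalIntegral.integral_of_le zero_le_one,
      integral_Ioc_eq_integral_Ioo]
    refine setIntegral_congr_fun measurableSet_Ioo fun x hx => ?_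
    simp only [hf]
    rw [integral_volterraKernel_mul K _ hx, RCLike.real_smul_eq_coe_mul]
    push_cast
    ring
  have hcont : Continuous fun p : ℝ × ℝ => jacobiSynthesis v p.2 *
      ((p.1 * (jacobi 1 0 m).eval (1 - p.1) : ℝ) : 𝕜) :=
    ((continuous_jacobiSynthesis v).comp continuous_snd).mul
      (RCLike.continuous_ofReal.comp (by fun_prop))
  rw [secondKindComposite_apply K hint, hR, setIntegral_triangle (by
    simpa only [mul_assoc] using integrableOn_triangle_mul hint hcont)]
  have hsub := intervalIntegral.integral_comp_sub_left (a := 0) (b := 1) f 1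
  rw [sub_self, sub_zero] at hsub
  rw [← hsub]
  congr 1 with x
  simp only [hf, sub_sub_cancel]
  rw [intervalIntegral.integral_mul_const, mul_comm]

end SecondKind

end VolterraJacobi

/-! ### Transfer of the Volterra operator to `ℓ²`. -/

theorem mainTheorem5 {𝕜 : Type*} [RCLike 𝕜] (K : ℝ → ℝ → 𝕜)
    (hK : MemLp (fun p : ℝ × ℝ => K p.1 p.2) 2
      (volume.restrict {p : ℝ × ℝ | 0 ≤ p.2 ∧ p.2 ≤ p.1 ∧ p.1 ≤ 1})) :
    ∃ (𝓔 : Lp 𝕜 2 jacobiMeasure ≃ₗᵢ[𝕜] lp (fun _ : ℕ => 𝕜) 2)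
      (C 𝒦 : lp (fun _ : ℕ => 𝕜) 2 →L[𝕜] lp (fun _ : ℕ => 𝕜) 2),
      -- `𝓔` is the analysis operator
      (∀ (u : Lp 𝕜 2 jacobiMeasure) (n : ℕ),
        𝓔 u n = ∫ x, (((jacobi 1 0 n).eval x : ℝ) : 𝕜) * u x ∂jacobiMeasure) ∧
      -- `C` is the composite operator on `ℓ²`, and it is compact
      (∀ (v : ℕ →₀ 𝕜) (w : lp (fun _ : ℕ => 𝕜) 2), (∀ n, w n = v n) →
        ∀ m, C w m = secondKindComposite K v m) ∧
      IsCompactOperator C ∧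
      -- the equation of the second kind is `(1 + 𝒦) u = g` with `𝒦` compact
      𝒦 = -C ∧ IsCompactOperator 𝒦 ∧
      ∀ u : Lp 𝕜 2 jacobiMeasure,
        (∀ᵐ x ∂jacobiMeasure, IntervalIntegrable (fun y => K x y * u y) volume 0 x) ∧
        ∀ g : Lp 𝕜 2 jacobiMeasure,
          (∀ᵐ x ∂jacobiMeasure, u x - ∫ y in (0 : ℝ)..x, K x y * u y = g x) ↔
            (1 + 𝒦) (𝓔 u) = 𝓔 g := by
  set b := jacobiHilbertBasis 𝕜
  have hk := memLp_volterraKernel hK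
  set V := integralOperator hk
  have hV : IsCompactOperator V := isCompactOperator_integralOperator hk b
  set E : Lp 𝕜 2 jacobiMeasure →L[𝕜] lp (fun _ : ℕ => 𝕜) 2 :=
    b.repr.toContinuousLinearEquiv.toContinuousLinearMap
  set E' : lp (fun _ : ℕ => 𝕜) 2 →L[𝕜] Lp 𝕜 2 jacobiMeasure :=
    b.repr.symm.toContinuousLinearEquiv.toContinuousLinearMap
  have hC : IsCompactOperator (E.comp (V.comp E')) := (hV.comp_clm E').clm_comp E
  have hVu : ∀ u : Lp 𝕜 2 jacobiMeasure,
      V u =ᵐ[jacobiMeasure] fun x => ∫ y in (0 : ℝ)..x, K x y * u y := fun u => by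
    filter_upwards [coeFn_integralOperator hk u, ae_mem_Ioo_jacobiMeasure] with x hx hx'
    rw [hx, integral_volterraKernel_mul K _ hx']
  refine ⟨b.repr, E.comp (V.comp E'), -(E.comp (V.comp E')), jacobiHilbertBasis_repr_apply,
    fun v w hvw m => ?_, hC, rfl, hC.neg, fun u => ⟨?_, fun g => ?_⟩⟩
  -- A finitely supported sequence synthesises to a finite combination of basis vectors, which
  -- agrees almost everywhere with `jacobiSynthesis v`, the function appearing in the matrix
  -- formula.
  · have hw : E' w = Finsupp.linearCombination 𝕜 b v := by
      show b.repr.symm w = _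
      rw [LinearIsometryEquiv.symm_apply_eq]
      ext n
      rw [hvw, HilbertBasis.repr_apply_apply, b.orthonormal.inner_right_finsupp]
    have hae : (E' w : ℝ → 𝕜) =ᵐ[jacobiMeasure] jacobiSynthesis v := by
      rw [hw]
      exact coeFn_linearCombination_jacobiHilbertBasis v
    show b.repr (V (E' w)) m = _
    rw [jacobiHilbertBasis_repr_apply, secondKindComposite_eq_integral hK]
    refine integral_congr_ae ?_
    filter_upwards [coeFn_integralOperator hk (E' w)] with x hx
    rw [hx]
    congr 1
    refine integral_congr_ae ?_
    filter_upwards [hae] with y hy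
    rw [hy]
  · filter_upwards [ae_integrable_kernel_mul hk u, ae_mem_Ioo_jacobiMeasure] with x hx hx'
    exact intervalIntegrable_of_integrable_volterraKernel_mul hx' hx
  -- Conjugation turns the `ℓ²` equation into `b.repr (u - V u) = b.repr g`; injectivity of `b.repr`
  -- reduces it to equality almost everywhere.
  · have hE : (1 + -(E.comp (V.comp E'))) (b.repr u) = b.repr (u - V u) := by
      show b.repr u + -(b.repr (V (b.repr.symm (b.repr u)))) = _
      rw [LinearIsometryEquiv.symm_apply_apply, map_sub, sub_eq_add_neg]
    rw [hE, b.repr.injective.eq_iff, Lp.ext_iff]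
    have hsub : (u - V u : Lp 𝕜 2 jacobiMeasure) =ᵐ[jacobiMeasure]
        fun x => u x - ∫ y in (0 : ℝ)..x, K x y * u y := by
      filter_upwards [Lp.coeFn_sub u (V u), hVu u] with x hx hx'
      rw [hx, Pi.sub_apply, hx']
    exact ⟨fun h => hsub.trans h, fun h => hsub.symm.trans h⟩
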